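/- **Theorem (Autocorrelation of dense Dirac combs).** Let $\widetilde L\subset\mathbb R^d\times\mathbb R^m$ be a lattice, let $|\det(\widetilde L)|$ be the volume of a fundamental domain of it, and let $\pi_1,\pi_2$ be the projections of $\mathbb R^d\times\mathbb R^m$ onto $\mathbb R^d$ and $\mathbb R^m$. Assume that $\pi_1|_{\widetilde L}$ and $\pi_2|_{\widetilde L}$ are both one-to-one and that $\pi_1(\widetilde L)$ and $\pi_2(\widetilde L)$ are dense in $\mathbb R^d$ and $\mathbb R^m$, respectively. Put $L=\pi_1(\widetilde L)$ and, for $x\in L$, let $x^\star=\pi_2\big((\pi_1|_{\widetilde L})^{-1}(x)\big)$. Let $f:\mathbb R^m\to\mathbb C$ be continuous with $|x|^{m+1+\alpha}|f(x)|\le C$ for all $x\in\mathbb R^m$, for some constants $C>0$ and $\alpha>0$. Then the weighted Dirac comb $\omega=\sum_{x\in L}f(x^\star)\,\delta_x$ is a well-defined complex measure on $\mathbb R^d$ (the weights are absolutely summable over bounded sets). For $r>0$ let $B_r\subset\mathbb R^d$ be the closed ball of radius $r$ centred at $0$, let $\omega_r=\omega|_{B_r}$, let $\widetilde{\omega_r}$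 be the measure $A\mapsto\overline{\omega_r(-A)}$, and let $\gamma_\omega^{(r)}=\frac1{\mathrm{vol}(B_r)}\,\omega_r*\widetilde{\omega_r}$ be the finite autocorrelation measures. As $r\to\infty$, the measures $\gamma^{(r)}_\omega$ converge vaguely, i.e. when integrated against every continuous compactly supported function $\mathbb R^d\to\mathbb C$, and the limit is the unique measure $$\gamma_\omega=\sum_{z\in L}\eta(z)\,\delta_z,\qquad \eta(z)=\frac1{|\det(\widetilde L)|}\int_{\mathbb R^m}f(u)\,\overline{f(u-z^\star)}\,du ,$$ where the integrals defining $\eta(z)$ converge absolutely and the $\eta(z)$ are absolutely summable over bounded sets. The measure $\gamma_\omega$ is * translation bounded: for every compact $K\subset\mathbb R^d$, $\sup_{y\in\mathbb R^d}|\gamma_\omega|(y+K)<\infty$, where $|\gamma_\omega|$ is the total variation measure; * positive definite: $\gamma_\omega(g*\widetilde g)\ge 0$ for every continuous compactly supported $g:\mathbb R^d\to\mathbb C$, where $\widetilde g(x)=\overline{g(-x)}$; * pure point: $\gamma_\omega(A)=\sum_{x\in A}\gamma_\omega(\{x\})$ for every bounded Borel set $A$. -/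

import Mathlib

open MeasureTheory Set Filter Topology Bornology

noncomputable section

namespace DenseComb

theorem hasSum_indicator_inter_iUnion {E M : Type*} [AddCommMonoid M] [TopologicalSpace M]
    (S : Set E) (c : E → M) {A : ℕ → Set E} (hd : Pairwise (Function.onFun Disjoint A)) (x : E) :
    HasSum (fun i => (S ∩ A i).indicator c x) ((S ∩ ⋃ i, A i).indicator c x) := by
  by_cases hx : x ∈ S ∩ ⋃ i, A i
  · obtain ⟨i, hi⟩ := mem_iUnion.1 hx.2
    have hxi : x ∈ S ∩ A i := mem_inter hx.1 hi
    rw [indicator_of_mem hx, ← indicator_of_mem hxi c]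
    exact hasSum_single i fun j hj =>
      indicator_of_notMem (fun h => disjoint_left.1 (hd hj) h.2 hi) _
  · rw [indicator_of_notMem hx]
    have h0 : (fun i => (S ∩ A i).indicator c x) = fun _ => 0 := by
      funext i
      exact indicator_of_notMem (fun h => hx (mem_inter h.1 (mem_iUnion.2 ⟨i, h.2⟩))) _
    rw [h0]
    exact hasSum_zero

section LocalMeasures

variable {E : Type*} [NormedAddCommGroup E] [MeasurableSpace E]

/-- A complex (in general not finite) Borel measure on `E` that is finite on bounded sets: a
countably additive complex function on the bounded Borel sets. The value on all other sets is `0`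
by convention, so that two such measures are equal iff they agree on bounded Borel sets. -/
@[ext]
structure LocalComplexMeasure (E : Type*) [NormedAddCommGroup E] [MeasurableSpace E] where
  measureOf : Set E → ℂ
  eq_zero_of_not : ∀ A, ¬ (MeasurableSet A ∧ IsBounded A) → measureOf A = 0
  hasSum_iUnion : ∀ A : ℕ → Set E, (∀ i, MeasurableSet (A i)) → IsBounded (⋃ i, A i) →
    Pairwise (Function.onFun Disjoint A) →
    HasSum (fun i => measureOf (A i)) (measureOf (⋃ i, A i))

namespace LocalComplexMeasure

theorem measureOf_empty (μ : LocalComplexMeasure E) : μ.measureOf ∅ = 0 := by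
  have h := μ.hasSum_iUnion (fun _ => ∅) (fun _ => MeasurableSet.empty) (by simp)
    (fun i j _ => by simp [Function.onFun])
  simpa using h.summable.tendsto_atTop_zero

open Classical in
/-- The restriction of `μ` to a bounded Borel set `B`, a finite complex measure
(`0` by convention if `B` is not a bounded Borel set). -/
def restrict (μ : LocalComplexMeasure E) (B : Set E) : ComplexMeasure E :=
  if hB : MeasurableSet B ∧ IsBounded B then
    { measureOf' := fun A => if MeasurableSet A then μ.measureOf (A ∩ B) else 0
      empty' := by simp [μ.measureOf_empty]
      not_measurable' := fun A hA => if_neg hA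
      m_iUnion' := by
        intro A hA hd
        rw [if_pos (MeasurableSet.iUnion hA), iUnion_inter]
        simp only [hA, if_true]
        exact μ.hasSum_iUnion _ (fun i => (hA i).inter hB.1)
          (hB.2.subset (iUnion_subset fun i => inter_subset_right))
          (fun i j hij => (hd hij).mono inter_subset_left inter_subset_left) }
  else 0

/-- `μ(g) = ∫ g dμ` for a function `g` with compact support. -/
def integral (μ : LocalComplexMeasure E) (g : E → ℂ) : ℂ :=
  ∫ᵛ x, g x ∂[ContinuousLinearMap.mul ℝ ℂ; μ.restrict (tsupport g)]

/-- `|μ|(A)`, the total variation measure of `μ` evaluated at a bounded Borel set `A`. -/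
def variation (μ : LocalComplexMeasure E) (A : Set E) : ENNReal :=
  (μ.restrict A).variation A

/-- For every compact `K`, `|μ|(y + K)` is bounded uniformly in `y`. -/
def TranslationBounded (μ : LocalComplexMeasure E) : Prop :=
  ∀ K : Set E, IsCompact K → ∃ C : NNReal, ∀ y : E, μ.variation ((fun x => y + x) '' K) ≤ C

/-- The measure of every bounded Borel set is the sum of the masses of its points. -/
def PurePoint (μ : LocalComplexMeasure E) : Prop :=
  ∀ A : Set E, MeasurableSet A → IsBounded A →
    HasSum (fun x : A => μ.measureOf {(x : E)}) (μ.measureOf A)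

end LocalComplexMeasure

/-- The function `x ↦ conj (g (-x))`. -/
def tildeFun (g : E → ℂ) : E → ℂ := fun x => starRingEnd ℂ (g (-x))

/-- `μ(g ∗ g̃)` is real and nonnegative for all compactly supported continuous `g`. -/
def LocalComplexMeasure.PositiveDefinite {d : ℕ}
    (μ : LocalComplexMeasure (EuclideanSpace ℝ (Fin d))) : Prop :=
  ∀ g : EuclideanSpace ℝ (Fin d) → ℂ, Continuous g → HasCompactSupport g →
    0 ≤ (μ.integral (convolution g (tildeFun g) (ContinuousLinearMap.mul ℝ ℂ) volume)).re ∧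
    (μ.integral (convolution g (tildeFun g) (ContinuousLinearMap.mul ℝ ℂ) volume)).im = 0

/-- The family of weights `c x`, `x ∈ S`, is summable over every bounded set. -/
def LocallySummable (S : Set E) (c : E → ℂ) : Prop :=
  ∀ B : Set E, IsBounded B → Summable ((S ∩ B).indicator c)

open Classical in
/-- The weighted Dirac comb `∑_{x ∈ S} c x δ_x`, for locally summable weights
(`0` by convention if the weights are not locally summable). -/
def diracComb (S : Set E) (c : E → ℂ) : LocalComplexMeasure E where
  measureOf A := if LocallySummable S c ∧ MeasurableSet A ∧ IsBounded A then
    ∑' x, (S ∩ A).indicator c x else 0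
  eq_zero_of_not A hA := if_neg fun h => hA h.2
  hasSum_iUnion A hA hb hd := by
    by_cases hS : LocallySummable S c
    · have hbi : ∀ i, IsBounded (A i) := fun i => hb.subset (subset_iUnion A i)
      simp only [hS, hA, hbi, hb, MeasurableSet.iUnion hA, and_self, if_true]
      have hs : Summable ((S ∩ ⋃ i, A i).indicator c) := hS _ hb
      have key := hasSum_indicator_inter_iUnion S c hd
      have keyn : ∀ x, HasSum (fun i => ‖(S ∩ A i).indicator c x‖)
          ‖(S ∩ ⋃ i, A i).indicator c x‖ := by
        simpa only [norm_indicator_eq_indicator_norm]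
          using hasSum_indicator_inter_iUnion S (fun x => ‖c x‖) hd
      have hp : Summable (fun p : E × ℕ => (S ∩ A p.2).indicator c p.1) := by
        refine Summable.of_norm ?_
        rw [summable_prod_of_nonneg (fun _ => norm_nonneg _)]
        refine ⟨fun x => (keyn x).summable, ?_⟩
        simp only [(keyn _).tsum_eq]
        exact hs.norm
      have h2 : HasSum (fun p : ℕ × E => (S ∩ A p.1).indicator c p.2)
          (∑' x, (S ∩ ⋃ i, A i).indicator c x) := by
        rw [← (Equiv.prodComm E ℕ).hasSum_iff]
        rw [(hp.hasSum.prod_fiberwise key).tsum_eq]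
        exact hp.hasSum
      exact h2.prod_fiberwise fun i => (hS _ (hbi i)).hasSum
    · simp [hS]

end LocalMeasures

section Autocorrelation

variable {d : ℕ}

/-- The complex measure `ν̃` with `ν̃(g) = conj (ν(g̃))`, that is, `ν̃(A) = conj (ν(-A))`. -/
def tildeMeasure (ν : ComplexMeasure (EuclideanSpace ℝ (Fin d))) :
    ComplexMeasure (EuclideanSpace ℝ (Fin d)) :=
  (ν.map fun x => -x).mapRange (starRingEnd ℂ : ℂ →+* ℂ).toAddMonoidHom Complex.continuous_conj

/-- The convolution of finite complex measures: the image of the product measure under addition. -/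
def convMeasure (μ ν : ComplexMeasure (EuclideanSpace ℝ (Fin d))) :
    ComplexMeasure (EuclideanSpace ℝ (Fin d)) :=
  (μ.prod ν (ContinuousLinearMap.mul ℝ ℂ)).map fun p => p.1 + p.2

/-- The finite autocorrelation `vol(B_r)⁻¹ ω_r ∗ (ω_r)~`, where `ω_r` is the restriction of `ω` to
the closed ball `B_r` of radius `r` centred at the origin. -/
def finiteAutocorrelation (ω : LocalComplexMeasure (EuclideanSpace ℝ (Fin d))) (r : ℝ) :
    ComplexMeasure (EuclideanSpace ℝ (Fin d)) :=
  (((volume.real (Metric.closedBall (0 : EuclideanSpace ℝ (Fin d)) r))⁻¹ : ℝ) : ℂ) •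
    convMeasure (ω.restrict (Metric.closedBall 0 r)) (tildeMeasure (ω.restrict (Metric.closedBall 0 r)))

/-- `γ` is the vague limit of the finite autocorrelations of `ω` as the radius tends to
infinity. -/
def IsAutocorrelation (ω γ : LocalComplexMeasure (EuclideanSpace ℝ (Fin d))) : Prop :=
  ∀ g : EuclideanSpace ℝ (Fin d) → ℂ, Continuous g → HasCompactSupport g →
    Tendsto (fun r : ℝ => ∫ᵛ x, g x ∂[ContinuousLinearMap.mul ℝ ℂ; finiteAutocorrelation ω r])
      atTop (𝓝 (γ.integral g))

end Autocorrelation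

section CutAndProject

variable {d m : ℕ}

/-- The conditions on a lattice in `ℝ^d × ℝ^m` under which both projections are one-to-one on the
lattice and have dense image. -/
structure IsDenseCutAndProject
    (Λ : Submodule ℤ (EuclideanSpace ℝ (Fin d) × EuclideanSpace ℝ (Fin m))) : Prop where
  injOn_fst : InjOn Prod.fst (Λ : Set (EuclideanSpace ℝ (Fin d) × EuclideanSpace ℝ (Fin m)))
  injOn_snd : InjOn Prod.snd (Λ : Set (EuclideanSpace ℝ (Fin d) × EuclideanSpace ℝ (Fin m)))
  dense_fst : Dense (Prod.fst '' (Λ : Set (EuclideanSpace ℝ (Fin d) × EuclideanSpace ℝ (Fin m))))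
  dense_snd : Dense (Prod.snd '' (Λ : Set (EuclideanSpace ℝ (Fin d) × EuclideanSpace ℝ (Fin m))))

/-- The projection `L` of the lattice to direct space. -/
def directModule (Λ : Submodule ℤ (EuclideanSpace ℝ (Fin d) × EuclideanSpace ℝ (Fin m))) :
    Set (EuclideanSpace ℝ (Fin d)) :=
  Prod.fst '' (Λ : Set (EuclideanSpace ℝ (Fin d) × EuclideanSpace ℝ (Fin m)))

/-- The star map `π₂ ∘ (π₁|_Λ)⁻¹`; only its values on `directModule Λ` are meaningful. -/
def starMap (Λ : Submodule ℤ (EuclideanSpace ℝ (Fin d) × EuclideanSpace ℝ (Fin m)))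
    (x : EuclideanSpace ℝ (Fin d)) : EuclideanSpace ℝ (Fin m) :=
  (Function.invFunOn Prod.fst
    (Λ : Set (EuclideanSpace ℝ (Fin d) × EuclideanSpace ℝ (Fin m))) x).2

/-- The dense weighted Dirac comb `ω = ∑_{x ∈ L} f(x⋆) δ_x`. -/
def denseComb (Λ : Submodule ℤ (EuclideanSpace ℝ (Fin d) × EuclideanSpace ℝ (Fin m)))
    (f : EuclideanSpace ℝ (Fin m) → ℂ) : LocalComplexMeasure (EuclideanSpace ℝ (Fin d)) :=
  diracComb (directModule Λ) fun x => f (starMap Λ x)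

/-- The autocorrelation coefficient `η(z) = |det Λ|⁻¹ ∫ f(u) conj (f(u - z⋆)) du`. -/
def autocorrCoeff (Λ : Submodule ℤ (EuclideanSpace ℝ (Fin d) × EuclideanSpace ℝ (Fin m)))
    (f : EuclideanSpace ℝ (Fin m) → ℂ) (z : EuclideanSpace ℝ (Fin d)) : ℂ :=
  ((ZLattice.covolume Λ volume : ℝ) : ℂ)⁻¹ * ∫ u, f u * starRingEnd ℂ (f (u - starMap Λ z))

end CutAndProject

end DenseComb

end

open MeasureTheory Set Filter Topology Bornology

noncomputable section

namespace DenseComb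

set_option linter.unusedSectionVars false

/-! ### Finite complex measures that are sums of point masses. -/

section AtomicMeasures

variable {X Y ι κ : Type*} [MeasurableSpace X] [MeasurableSpace Y]

/-! Write `W(u) = (1 + ‖u‖)⁻ⁿ` with `n = m + 1`. The decay hypothesis gives `f = O(W)`, and even `f
= o(W)` thanks to `α`; and `W` is integrable on `ℝ^m`. Comparing each lattice point with its
translate of a fundamental domain bounds the sum of `W` over the lattice points above a set by a
constant times the volume of a neighbourhood of that set (`exists_tsum_decayWeight_le`). This
estimate gives local summability, translation boundedness and all dominations.

The core is equidistribution (`CountingBound.tendsto_latSum`): averages of `G ∘ π₂` over the lattice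
points above `B_r` tend to `|det Λ|⁻¹ ∫ G`. Averages of translates by `(s, v)` are asymptotically
the same as the untranslated ones: by density of `π₂(Λ)` a lattice vector can be subtracted to make
`v` small, where uniform continuity relative to `W` applies, and the remaining shift of the ball
costs only a boundary annulus. Integrating the translated sums over a fundamental domain unfolds to
exactly `vol(B_r) ∫ G`, and dominated convergence identifies the limit.

The finite autocorrelation is an atomic measure with atoms at differences of lattice points. Grouped
by the difference `z`, its coefficient is such an average for `G(u) = f(u) conj (f(u - z⋆))`, up to
a boundary correction, hence tends to `η(z)`. The inequality `decayWeight_mul_le` bounds these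
coefficients by a multiple of `W(z⋆)` for all large `r`, so the limit may be taken inside the sum
over `z` (`CountingBound.isAutocorrelation`). Positive definiteness holds for each `r` and survives
the limit; uniqueness holds because test functions determine a measure. -/

instance isFiniteMeasure_variation (ν : ComplexMeasure X) : IsFiniteMeasure ν.variation := by
  -- Real and imaginary parts have finite total variation. Finiteness makes bounded measurable
  -- functions integrable against every complex measure.
  have h : ν.variation ≤ (ComplexMeasure.re ν).totalVariation
      + (ComplexMeasure.im ν).totalVariation := by
    refine VectorMeasure.variation_le_of_forall_enorm_le fun A _ => ?_
    calc ‖ν A‖ₑ = ‖((ν A).re : ℂ) + (ν A).im * Complex.I‖ₑ := by rw [Complex.re_add_im]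
      _ ≤ ‖((ν A).re : ℂ)‖ₑ + ‖(ν A).im * Complex.I‖ₑ := enorm_add_le _ _
      _ = ‖(ν A).re‖ₑ + ‖(ν A).im‖ₑ := by
        congr 1
        · simp [← ofReal_norm]
        · simp [← ofReal_norm]
      _ ≤ _ := by
        rw [Measure.add_apply]
        exact add_le_add (SignedMeasure.enorm_le_totalVariation (ComplexMeasure.re ν) A)
          (SignedMeasure.enorm_le_totalVariation (ComplexMeasure.im ν) A)
  exact isFiniteMeasure_of_le _ h

/-- `ν` is the sum of the point masses `c i` at the points `p i`, with summable weights. -/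
structure IsAtomic (ν : ComplexMeasure X) (p : ι → X) (c : ι → ℂ) : Prop where
  summable : Summable c
  hasSum : ∀ A, MeasurableSet A → HasSum ((p ⁻¹' A).indicator c) (ν A)

namespace IsAtomic

variable {ν : ComplexMeasure X} {p : ι → X} {c : ι → ℂ}

/-- The positive measure `∑ ‖c i‖ δ_{p i}` dominates `‖ν A‖` on measurable sets, and the variation
is the least measure doing so. Equality may fail, since the points `p i` may repeat. -/
theorem variation_apply_le (h : IsAtomic ν p c) {A : Set X} (hA : MeasurableSet A) :
    ν.variation A ≤ ∑' i, (p ⁻¹' A).indicator (fun i => ‖c i‖ₑ) i := by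
  have hle : ν.variation ≤ Measure.sum fun i => ‖c i‖ₑ • Measure.dirac (p i) := by
    refine VectorMeasure.variation_le_of_forall_enorm_le fun A hA => ?_
    rw [← (h.hasSum A hA).tsum_eq, Measure.sum_apply _ hA]
    refine enorm_tsum_le_tsum_enorm.trans (ENNReal.tsum_le_tsum fun i => ?_)
    by_cases hi : p i ∈ A <;> simp [hi, hA]
  refine (hle A).trans ?_
  rw [Measure.sum_apply _ hA]
  refine ENNReal.tsum_le_tsum fun i => ?_
  by_cases hi : p i ∈ A <;> simp [hi, hA]

theorem sub_sum_dirac (h : IsAtomic ν p c) (s : Finset ι) :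
    IsAtomic (ν - ∑ i ∈ s, VectorMeasure.dirac (p i) (c i)) p ((s : Set ι)ᶜ.indicator c) := by
  classical
  refine ⟨h.summable.indicator _, fun A hA => ?_⟩
  have h1 : HasSum ((p ⁻¹' A).indicator ((s : Set ι).indicator c))
      ((∑ i ∈ s, VectorMeasure.dirac (p i) (c i)) A) := by
    have : ((∑ i ∈ s, VectorMeasure.dirac (p i) (c i)) A)
        = ∑ i ∈ s, (p ⁻¹' A).indicator ((s : Set ι).indicator c) i := by
      rw [FunLike.coe_sum, Finset.sum_apply]
      refine Finset.sum_congr rfl fun i hi => ?_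
      by_cases hi' : p i ∈ A <;> simp [hi', hA, hi]
    rw [this]
    refine hasSum_sum_of_ne_finset_zero fun i hi => ?_
    simp [indicator, hi]
  have h2 := (h.hasSum A hA).sub h1
  convert! h2 using 1
  funext i
  by_cases hi : i ∈ s <;> by_cases hi' : p i ∈ A <;> simp [hi, hi']

/-- Removing finitely many atoms leaves an atomic measure whose variation is at most the tail of `∑
‖c i‖`; the error of a partial sum is an integral of a bounded function against it. -/
theorem hasSum_integral (h : IsAtomic ν p c) {g : X → ℂ} (hg : StronglyMeasurable g) {C : ℝ}
    (hC : ∀ x, ‖g x‖ ≤ C) :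
    HasSum (fun i => g (p i) * c i) (∫ᵛ x, g x ∂[ContinuousLinearMap.mul ℝ ℂ; ν]) := by
  classical
  have hint : ∀ μ : ComplexMeasure X, μ.Integrable g := fun μ =>
    Integrable.of_bound hg.aestronglyMeasurable C (Eventually.of_forall hC)
  rw [HasSum, SummationFilter.unconditional_filter, tendsto_iff_norm_sub_tendsto_zero]
  have hsum : ∑' i, ‖c i‖ₑ ≠ ⊤ := by
    have := h.summable.norm
    have h3 := this.tsum_ofReal_ne_top
    simpa using h3
  have htail := (ENNReal.tendsto_toReal ENNReal.zero_ne_top).comp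
    (ENNReal.tendsto_tsum_compl_atTop_zero hsum)
  have htail2 := htail.const_mul |C|
  simp only [ENNReal.toReal_zero, mul_zero] at htail2
  refine squeeze_zero (fun _ => norm_nonneg _) (fun s => ?_) htail2
  have heq : ∫ᵛ x, g x ∂[ContinuousLinearMap.mul ℝ ℂ; ν] - ∑ i ∈ s, g (p i) * c i
      = ∫ᵛ x, g x ∂[ContinuousLinearMap.mul ℝ ℂ;
        ν - ∑ i ∈ s, VectorMeasure.dirac (p i) (c i)] := by
    rw [VectorMeasure.integral_sub_vectorMeasure (hint _) (hint _),
      VectorMeasure.integral_finsetSum_vectorMeasure (fun i _ => hint _)]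
    congr 1
    refine Finset.sum_congr rfl fun i _ => ?_
    rw [VectorMeasure.integral_dirac' hg]
    rfl
  rw [norm_sub_rev, heq]
  have hv := (h.sub_sum_dirac s).variation_apply_le MeasurableSet.univ
  -- The absolute value is needed because `C` may be negative when `X` is empty.
  have hC0 : ∀ x, ‖g x‖ ≤ |C| := fun x => (hC x).trans (le_abs_self C)
  refine (VectorMeasure.norm_integral_le_of_norm_le_const (Eventually.of_forall hC0)).trans ?_
  have hB : ‖ContinuousLinearMap.mul ℝ ℂ‖ ≤ 1 := ContinuousLinearMap.opNorm_mul_le ℝ ℂ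
  have hv2 : (ν - ∑ i ∈ s, VectorMeasure.dirac (p i) (c i)).variation.real univ
      ≤ (∑' b : {x // x ∉ s}, ‖c b‖ₑ).toReal := by
    refine ENNReal.toReal_mono ?_ (hv.trans (le_of_eq ?_))
    · exact ne_top_of_le_ne_top hsum (ENNReal.tsum_comp_le_tsum_of_injective
        Subtype.val_injective _)
    · have := tsum_subtype ((s : Set ι)ᶜ) (fun i => ‖c i‖ₑ)
      refine Eq.trans ?_ this.symm
      refine tsum_congr fun i => ?_
      by_cases hi : i ∈ s <;> simp [hi]
  calc |C| * ‖ContinuousLinearMap.mul ℝ ℂ‖ * _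
      ≤ |C| * 1 * (∑' b : {x // x ∉ s}, ‖c b‖ₑ).toReal := by gcongr
    _ = _ := by rw [mul_one]; rfl

theorem map (h : IsAtomic ν p c) {φ : X → Y} (hφ : Measurable φ) :
    IsAtomic (ν.map φ) (φ ∘ p) c := by
  refine ⟨h.summable, fun A hA => ?_⟩
  rw [VectorMeasure.map_apply _ hφ hA]
  exact h.hasSum _ (hφ hA)

theorem mapRange_conj (h : IsAtomic ν p c) :
    IsAtomic (ν.mapRange (starRingEnd ℂ : ℂ →+* ℂ).toAddMonoidHom Complex.continuous_conj) p
      (fun i => starRingEnd ℂ (c i)) := by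
  refine ⟨(Complex.hasSum_conj'.2 h.summable.hasSum).summable, fun A hA => ?_⟩
  rw [VectorMeasure.mapRange_apply]
  have := Complex.hasSum_conj'.2 (h.hasSum A hA)
  convert! this using 1
  funext i
  by_cases hi : p i ∈ A <;> simp [hi]

theorem smul (h : IsAtomic ν p c) (a : ℂ) : IsAtomic (a • ν) p (fun i => a * c i) := by
  refine ⟨h.summable.mul_left a, fun A hA => ?_⟩
  rw [_root_.smul_apply]
  convert! (h.hasSum A hA).mul_left a using 1
  funext i
  by_cases hi : p i ∈ A <;> simp [hi]

/-- The mass of `A` is the `ν`-integral of the `μ`-masses of its sections, hence an iterated sum.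
Absolute summability of `c i * e k` identifies it with the double sum. -/
theorem prod (h : IsAtomic ν p c) {μ : ComplexMeasure Y} {q : κ → Y} {e : κ → ℂ}
    (h' : IsAtomic μ q e) :
    IsAtomic (ν.prod μ (ContinuousLinearMap.mul ℝ ℂ)) (fun i : ι × κ => (p i.1, q i.2))
      (fun i => c i.1 * e i.2) := by
  have hs : Summable fun i : ι × κ => c i.1 * e i.2 :=
    summable_mul_of_summable_norm h.summable.norm h'.summable.norm
  refine ⟨hs, fun A hA => ?_⟩
  have hflip : (ContinuousLinearMap.mul ℝ ℂ).flip = ContinuousLinearMap.mul ℝ ℂ := by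
    ext; simp
  rw [VectorMeasure.prod_apply_eq_integral hA, hflip]
  have h1 := h.hasSum_integral
    (VectorMeasure.stronglyMeasurable_vectorMeasure_prodMk_left (ν := μ) hA)
    (C := μ.bound) (fun x => VectorMeasure.norm_apply_le_bound)
  have h2 := (hs.indicator ((fun i : ι × κ => (p i.1, q i.2)) ⁻¹' A)).hasSum
  have h3 := h2.prod_fiberwise (g := fun i => μ (Prod.mk (p i) ⁻¹' A) * c i) fun i => by
    have := (h'.hasSum _ (measurable_prodMk_left (x := p i) hA)).mul_right (c i)
    convert! this using 1
    funext k
    by_cases hk : (p i, q k) ∈ A <;> simp [hk, mul_comm]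
  rw [← h1.unique h3] at h2
  exact h2

end IsAtomic

end AtomicMeasures

/-! ### Dirac combs as atomic measures. -/

section Combs

variable {E : Type*} [NormedAddCommGroup E] [MeasurableSpace E]

theorem LocalComplexMeasure.restrict_apply (μ : LocalComplexMeasure E) {B A : Set E}
    (hB : MeasurableSet B) (hB' : IsBounded B) (hA : MeasurableSet A) :
    μ.restrict B A = μ.measureOf (A ∩ B) := by
  rw [LocalComplexMeasure.restrict, dif_pos ⟨hB, hB'⟩]
  exact if_pos hA

theorem diracComb_measureOf {S : Set E} {c : E → ℂ} (h : LocallySummable S c) {A : Set E}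
    (hA : MeasurableSet A) (hA' : IsBounded A) :
    (diracComb S c).measureOf A = ∑' x, (S ∩ A).indicator c x :=
  if_pos ⟨h, hA, hA'⟩

theorem isAtomic_restrict_diracComb {S : Set E} {c : E → ℂ} (h : LocallySummable S c) {B : Set E}
    (hB : MeasurableSet B) (hB' : IsBounded B) :
    IsAtomic ((diracComb S c).restrict B) id ((S ∩ B).indicator c) := by
  refine ⟨h B hB', fun A hA => ?_⟩
  rw [LocalComplexMeasure.restrict_apply _ hB hB' hA,
    diracComb_measureOf h (hA.inter hB) (hB'.subset inter_subset_right)]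
  have := (h _ (hB'.subset (inter_subset_right (s := A)))).hasSum
  convert this using 1
  rw [preimage_id, indicator_indicator]
  congr 1
  ext x
  simp only [mem_inter_iff]
  tauto

/-- Allows atoms indexed by points of the space to be reindexed by lattice points. -/
theorem IsAtomic.comp_injective {X ι κ : Type*} [MeasurableSpace X] {ν : ComplexMeasure X}
    {p : ι → X} {c : ι → ℂ} (h : IsAtomic ν p c) {j : κ → ι} (hj : Function.Injective j)
    (hsupp : ∀ i, c i ≠ 0 → i ∈ range j) : IsAtomic ν (p ∘ j) (c ∘ j) := by
  refine ⟨h.summable.comp_injective hj, fun A hA => ?_⟩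
  have := (hj.hasSum_iff (f := (p ⁻¹' A).indicator c) (a := ν A) fun i hi => by
    by_contra hne
    refine hi (hsupp i fun h0 => hne ?_)
    simp [indicator, h0]).2 (h.hasSum A hA)
  convert! this using 1

theorem purePoint_diracComb [MeasurableSingletonClass E] {S : Set E} {c : E → ℂ}
    (h : LocallySummable S c) : (diracComb S c).PurePoint := by
  classical
  intro A hA hA'
  rw [diracComb_measureOf h hA hA']
  have h1 := (h A hA').hasSum
  have h2 : (fun x : A => (diracComb S c).measureOf {(x : E)})
      = (S.indicator c) ∘ (Subtype.val : A → E) := by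
    funext x
    rw [diracComb_measureOf h (measurableSet_singleton _) isBounded_singleton]
    refine (tsum_eq_single (x : E) fun y hy => ?_).trans ?_
    · exact indicator_of_notMem (fun hy' => hy hy'.2) _
    · simp [indicator]
  rw [h2, hasSum_subtype_iff_indicator, indicator_indicator, inter_comm]
  exact h1

end Combs

/-! ### Test functions determine a measure. -/

section Uniqueness

variable {E : Type*} [NormedAddCommGroup E] [MeasurableSpace E] [BorelSpace E]

/-- Frees the integral from the support of the individual function, so that a whole sequence of test
functions can be integrated against one finite measure. -/
theorem LocalComplexMeasure.integral_eq_of_tsupport_subset (μ : LocalComplexMeasure E) {g : E → ℂ}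
    (hg' : HasCompactSupport g) {B : Set E} (hB : MeasurableSet B)
    (hB' : IsBounded B) (hgB : tsupport g ⊆ B) :
    μ.integral g = ∫ᵛ x, g x ∂[ContinuousLinearMap.mul ℝ ℂ; μ.restrict B] := by
  have hm : MeasurableSet (tsupport g) := (isClosed_tsupport g).measurableSet
  have hb : IsBounded (tsupport g) := IsCompact.isBounded hg'
  have : μ.restrict (tsupport g) = (μ.restrict B).restrict (tsupport g) := by
    refine VectorMeasure.ext fun A hA => ?_
    rw [VectorMeasure.restrict_apply _ hm hA, restrict_apply _ hm hb hA,
      restrict_apply _ hB hB' (hA.inter hm), inter_assoc, inter_eq_left.2 hgB]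
  rw [LocalComplexMeasure.integral, this]
  exact VectorMeasure.setIntegral_eq_integral_of_forall_compl_eq_zero hm
    fun x hx => image_eq_zero_of_notMem_tsupport hx

/-- Measures are determined by their integrals against compactly supported continuous
functions. -/
theorem LocalComplexMeasure.ext_of_integral [ProperSpace E] {μ ν : LocalComplexMeasure E}
    (h : ∀ g : E → ℂ, Continuous g → HasCompactSupport g → μ.integral g = ν.integral g) :
    μ = ν := by
  -- The indicator of `K` is the pointwise limit of continuous thickened indicators bounded by `1`.
  -- Widths at most `1` keep all supports in one compact set `B`, so dominated convergence applies.
  have key : ∀ K : Set E, IsCompact K → μ.measureOf K = ν.measureOf K := by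
    intro K hK
    let u : ℕ → ℝ := fun n => 1 / ((n : ℝ) + 1)
    have hu : ∀ n, 0 < u n := fun n => by positivity
    have hulim : Tendsto u atTop (𝓝 0) := tendsto_one_div_add_atTop_nhds_zero_nat
    have hu1 : ∀ n, u n ≤ 1 := fun n => by
      rw [div_le_one (by positivity)]
      linarith [(Nat.cast_nonneg n : (0 : ℝ) ≤ n)]
    let G : ℕ → E → ℂ := fun n x => ((thickenedIndicator (hu n) K x : NNReal) : ℝ)
    have hGc : ∀ n, Continuous (G n) := fun n =>
      Complex.continuous_ofReal.comp
        (NNReal.continuous_coe.comp (thickenedIndicator (hu n) K).continuous)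
    let B : Set E := Metric.cthickening 1 K
    have hBc : IsCompact B := hK.cthickening
    have hGz : ∀ n x, x ∉ B → G n x = 0 := fun n x hx => by
      have : x ∉ Metric.thickening (u n) K := fun hx' =>
        hx (Metric.thickening_subset_cthickening_of_le (hu1 n) K hx')
      have h0 := thickenedIndicator_zero (hu n) K this
      simp only [G, h0, NNReal.coe_zero, Complex.ofReal_zero]
    have hGs : ∀ n, tsupport (G n) ⊆ B := fun n =>
      closure_minimal (fun x hx => by_contra fun hxB => hx (hGz n x hxB)) hBc.isClosed
    have hGcs : ∀ n, HasCompactSupport (G n) := fun n =>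
      hBc.of_isClosed_subset (isClosed_tsupport _) (hGs n)
    have hlim : ∀ τ : LocalComplexMeasure E,
        Tendsto (fun n => τ.integral (G n)) atTop (𝓝 (τ.measureOf K)) := by
      intro τ
      have h1 : τ.measureOf K = ∫ᵛ x, K.indicator (fun _ => (1 : ℂ)) x
          ∂[ContinuousLinearMap.mul ℝ ℂ; τ.restrict B] := by
        rw [VectorMeasure.integral_indicator_const _ hK.measurableSet,
          restrict_apply _ hBc.measurableSet hBc.isBounded hK.measurableSet,
          inter_eq_left.2 (Metric.self_subset_cthickening K)]
        simp
      rw [h1]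
      simp_rw [fun n => τ.integral_eq_of_tsupport_subset (hGcs n) hBc.measurableSet
        hBc.isBounded (hGs n)]
      refine VectorMeasure.tendsto_integral_filter_of_norm_le_const
        (Eventually.of_forall fun n => (hGc n).aestronglyMeasurable) ⟨1, ?_⟩ ?_
      · refine Eventually.of_forall fun n => Eventually.of_forall fun x => ?_
        have := thickenedIndicator_le_one (hu n) K x
        simpa [G] using this
      · refine Eventually.of_forall fun x => ?_
        have h2 := thickenedIndicator_tendsto_indicator_closure hu hulim K
        rw [tendsto_pi_nhds] at h2
        have h3 := h2 x
        rw [hK.isClosed.closure_eq] at h3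
        have h4 := (Complex.continuous_ofReal.tendsto _).comp
          ((NNReal.continuous_coe.tendsto _).comp h3)
        have h5 : (((K.indicator (fun _ => (1 : NNReal)) x : NNReal) : ℝ) : ℂ)
            = K.indicator (fun _ => (1 : ℂ)) x := by
          by_cases hx : x ∈ K <;> simp [hx]
        rw [← h5]
        exact h4
    refine tendsto_nhds_unique (hlim μ) ?_
    simp_rw [fun n => h (G n) (hGc n) (hGcs n)]
    exact hlim ν
  -- Closed sets form a π-system generating the Borel sets, and their traces on a ball are compact.
  have hball : ∀ R : ℝ, μ.restrict (Metric.closedBall 0 R) = ν.restrict (Metric.closedBall 0 R) := by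
    intro R
    have hBc : IsCompact (Metric.closedBall (0 : E) R) := isCompact_closedBall 0 R
    refine VectorMeasure.ext_of_generateFrom {s : Set E | IsClosed s} (fun s hs => ?_)
      (BorelSpace.measurable_eq.trans borel_eq_generateFrom_isClosed) ?_ ?_
    · rw [restrict_apply _ hBc.measurableSet hBc.isBounded (IsClosed.measurableSet hs),
        restrict_apply _ hBc.measurableSet hBc.isBounded (IsClosed.measurableSet hs)]
      exact key _ (hBc.inter_left hs)
    · exact isPiSystem_isClosed
    · rw [restrict_apply _ hBc.measurableSet hBc.isBounded MeasurableSet.univ,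
        restrict_apply _ hBc.measurableSet hBc.isBounded MeasurableSet.univ, univ_inter]
      exact key _ hBc
  ext A
  by_cases hA : MeasurableSet A ∧ IsBounded A
  · obtain ⟨R, hR⟩ := hA.2.subset_closedBall 0
    have : μ.restrict (Metric.closedBall 0 R) A = ν.restrict (Metric.closedBall 0 R) A := by
      rw [hball R]
    rwa [restrict_apply _ Metric.isClosed_closedBall.measurableSet Metric.isBounded_closedBall hA.1,
      restrict_apply _ Metric.isClosed_closedBall.measurableSet Metric.isBounded_closedBall hA.1,
      inter_eq_left.2 hR] at this
  · rw [μ.eq_zero_of_not A hA, ν.eq_zero_of_not A hA]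

end Uniqueness

/-! ### The polynomial weight and its inequalities. -/

section Weight

variable {F : Type*} [NormedAddCommGroup F]

/-- The polynomially decaying weight `(1 + ‖u‖)⁻ⁿ`. -/
def decayWeight (n : ℕ) (u : F) : ℝ := ((1 + ‖u‖) ^ n)⁻¹

theorem decayWeight_pos (n : ℕ) (u : F) : 0 < decayWeight n u := by
  unfold decayWeight; positivity

theorem decayWeight_le_one (n : ℕ) (u : F) : decayWeight n u ≤ 1 := by
  refine inv_le_one_of_one_le₀ (one_le_pow₀ ?_)
  linarith [norm_nonneg u]

theorem continuous_decayWeight (n : ℕ) : Continuous (decayWeight n : F → ℝ) := by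
  unfold decayWeight
  refine Continuous.inv₀ (by fun_prop) fun u => ?_
  positivity

/-- This is `1 + ‖u + v‖ ≤ (1 + ‖u‖)(1 + ‖v‖)`: bounded shifts change the weight only by a bounded
factor. -/
theorem decayWeight_le_mul (n : ℕ) (u v : F) :
    decayWeight n u ≤ (1 + ‖v‖) ^ n * decayWeight n (u + v) := by
  unfold decayWeight
  rw [← div_eq_mul_inv, le_div_iff₀ (by positivity), inv_mul_le_iff₀ (by positivity), ← mul_pow]
  refine pow_le_pow_left₀ (by positivity) ?_ n
  nlinarith [norm_add_le u v, norm_nonneg u, norm_nonneg v, mul_nonneg (norm_nonneg u) (norm_nonneg v)]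

/-- The larger of `‖u‖` and `‖u - v‖` is at least `‖v‖ / 2`, so its weight is at most `2ⁿ` times
that of `v`; the other weight is kept. Thus correlations of functions of size `W` are again of size
`W` in the shift. -/
theorem decayWeight_mul_le (n : ℕ) (u v : F) :
    decayWeight n u * decayWeight n (u - v)
      ≤ 2 ^ n * decayWeight n v * (decayWeight n u + decayWeight n (u - v)) := by
  have key : ∀ a b : F, ‖b‖ ≤ 1 + 2 * ‖a‖ → decayWeight n a ≤ 2 ^ n * decayWeight n b := by
    intro a b h
    unfold decayWeight
    rw [← div_eq_mul_inv, le_div_iff₀ (by positivity), inv_mul_le_iff₀ (by positivity), ← mul_pow]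
    refine pow_le_pow_left₀ (by positivity) ?_ n
    linarith
  have hv : ‖v‖ ≤ ‖u‖ + ‖u - v‖ := by
    have := norm_sub_le u (u - v)
    rwa [sub_sub_cancel] at this
  have p1 := decayWeight_pos n u
  have p2 := decayWeight_pos n (u - v)
  have p3 := decayWeight_pos n v
  rcases le_total ‖u‖ ‖u - v‖ with h | h
  · have h1 := key (u - v) v (by linarith)
    nlinarith [mul_le_mul_of_nonneg_left h1 p1.le, mul_pos (mul_pos (pow_pos two_pos n) p3) p2]
  · have h1 := key u v (by linarith)
    nlinarith [mul_le_mul_of_nonneg_right h1 p2.le, mul_pos (mul_pos (pow_pos two_pos n) p3) p1]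

theorem integrable_decayWeight [NormedSpace ℝ F] [FiniteDimensional ℝ F] [MeasurableSpace F]
    [BorelSpace F] (μ : Measure F) [μ.IsAddHaarMeasure] {n : ℕ} (hn : Module.finrank ℝ F < n) :
    Integrable (decayWeight n : F → ℝ) μ := by
  have := integrable_one_add_norm (E := F) (μ := μ) (r := n) (by exact_mod_cast hn)
  refine this.congr (Eventually.of_forall fun u => ?_)
  have : (0 : ℝ) ≤ 1 + ‖u‖ := by positivity
  simp only [decayWeight]
  rw [Real.rpow_neg this, Real.rpow_natCast]

/-- Functions decaying faster than the weight are uniformly continuous relative to the weight. -/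
theorem exists_norm_sub_le_mul_decayWeight [ProperSpace F] {n : ℕ} {G : F → ℂ} (hG : Continuous G)
    (hlim : Tendsto (fun u => ‖G u‖ / decayWeight n u) (cocompact F) (𝓝 0)) {ε : ℝ} (hε : 0 < ε) :
    ∃ δ > 0, ∀ w : F, ‖w‖ < δ → ∀ u, ‖G (u + w) - G u‖ ≤ ε * decayWeight n u := by
  -- Far from the origin the two values of `G` are estimated separately. The one at `u + w` loses a
  -- factor `2ⁿ`, and `2ⁿ η + η ≤ ε`.
  set η : ℝ := ε / (2 * 2 ^ n) with hη
  have hηpos : 0 < η := by positivity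
  have hηε : 2 ^ n * η + η ≤ ε := by
    have : 2 ^ n * η = ε / 2 := by rw [hη]; field_simp
    have h1 : (1 : ℝ) ≤ 2 ^ n := one_le_pow₀ (by norm_num)
    nlinarith
  have h1 := (hlim.eventually (gt_mem_nhds hηpos))
  rw [← Metric.cobounded_eq_cocompact, ← comap_norm_atTop, eventually_comap] at h1
  obtain ⟨R, hR⟩ := eventually_atTop.1 h1
  have hfar : ∀ u : F, R ≤ ‖u‖ → ‖G u‖ ≤ η * decayWeight n u := fun u hu => by
    have := hR ‖u‖ hu u rfl
    rw [div_lt_iff₀ (decayWeight_pos n u)] at this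
    exact this.le
  have hRW : 0 < ((1 + (|R| + 1)) ^ n : ℝ)⁻¹ := by positivity
  have hunif := (isCompact_closedBall (0 : F) (|R| + 2)).uniformContinuousOn_of_continuous
    hG.continuousOn
  -- The factor after `ε` is the least value of the weight on the ball of radius `|R| + 1`. The
  -- larger radius `|R| + 2` also contains `u + w`, since `‖w‖ < 1`.
  obtain ⟨δ, hδ, hδ'⟩ := Metric.uniformContinuousOn_iff.1 hunif (ε * ((1 + (|R| + 1)) ^ n)⁻¹)
    (by positivity)
  refine ⟨min δ 1, lt_min hδ one_pos, fun w hw u => ?_⟩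
  have hw1 : ‖w‖ < 1 := hw.trans_le (min_le_right _ _)
  by_cases hu : ‖u‖ ≤ |R| + 1
  · have h2 := hδ' (u + w) (by
      rw [mem_closedBall_zero_iff]; linarith [norm_add_le u w]) u (by
      rw [mem_closedBall_zero_iff]; linarith) (by
      rw [dist_eq_norm, add_sub_cancel_left]; exact hw.trans_le (min_le_left _ _))
    rw [dist_eq_norm] at h2
    refine h2.le.trans (mul_le_mul_of_nonneg_left ?_ hε.le)
    unfold decayWeight
    gcongr
  · push Not at hu
    have hu2 : R ≤ ‖u + w‖ := by
      have := norm_sub_le (u + w) w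
      rw [add_sub_cancel_right] at this
      linarith [le_abs_self R]
    have hu1 : R ≤ ‖u‖ := by linarith [le_abs_self R]
    have h3 : decayWeight n (u + w) ≤ 2 ^ n * decayWeight n u := by
      have := decayWeight_le_mul n (u + w) (-w)
      rw [add_neg_cancel_right, norm_neg] at this
      refine this.trans (mul_le_mul_of_nonneg_right ?_ (decayWeight_pos n u).le)
      refine pow_le_pow_left₀ (by positivity) ?_ n
      linarith
    calc ‖G (u + w) - G u‖ ≤ ‖G (u + w)‖ + ‖G u‖ := norm_sub_le _ _
      _ ≤ η * (2 ^ n * decayWeight n u) + η * decayWeight n u :=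
        add_le_add ((hfar _ hu2).trans (mul_le_mul_of_nonneg_left h3 hηpos.le)) (hfar _ hu1)
      _ = (2 ^ n * η + η) * decayWeight n u := by ring
      _ ≤ _ := mul_le_mul_of_nonneg_right hηε (decayWeight_pos n u).le

end Weight

/-! ### Unfolding and weighted lattice point counting. -/

section LatticeSums

theorem countable_lattice {V : Type*} [NormedAddCommGroup V] [NormedSpace ℝ V]
    [FiniteDimensional ℝ V] (Λ : Submodule ℤ V) [DiscreteTopology Λ] : Countable Λ :=
  TopologicalSpace.separableSpace_iff_countable.1 inferInstance

variable {E F : Type*} [NormedAddCommGroup E] [NormedSpace ℝ E] [FiniteDimensional ℝ E]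
  [MeasureSpace E] [BorelSpace E] [(volume : Measure E).IsAddHaarMeasure]
  [NormedAddCommGroup F] [NormedSpace ℝ F] [FiniteDimensional ℝ F]
  [MeasureSpace F] [BorelSpace F] [(volume : Measure F).IsAddHaarMeasure]

instance isAddHaarMeasure_volume_prod : (volume : Measure (E × F)).IsAddHaarMeasure :=
  inferInstanceAs ((volume : Measure E).prod (volume : Measure F)).IsAddHaarMeasure

theorem exists_bounded_fundamentalDomain (Λ : Submodule ℤ (E × F)) [DiscreteTopology Λ]
    [IsZLattice ℝ Λ] :
    ∃ D : Set (E × F), IsAddFundamentalDomain Λ D volume ∧ MeasurableSet D ∧ IsBounded D ∧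
      volume.real D = ZLattice.covolume Λ volume ∧ volume D ≠ 0 ∧ volume D ≠ ⊤ := by
  have : Module.Free ℤ Λ := ZLattice.module_free ℝ Λ
  let b := Module.Free.chooseBasis ℤ Λ
  have hD := ZLattice.isAddFundamentalDomain b (volume : Measure (E × F))
  have hcov := ZLattice.covolume_eq_measure_fundamentalDomain Λ volume hD
  have hbdd := ZSpan.fundamentalDomain_isBounded (b.ofZLatticeBasis ℝ Λ)
  exact ⟨_, hD, ZSpan.fundamentalDomain_measurableSet _, hbdd, hcov.symm,
    ZSpan.measure_fundamentalDomain_ne_zero _, hbdd.measure_lt_top.ne⟩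

theorem lintegral_eq_tsum_lattice {Λ : Submodule ℤ (E × F)} [DiscreteTopology Λ] {D : Set (E × F)}
    (hD : IsAddFundamentalDomain Λ D (volume : Measure (E × F))) (H : E × F → ENNReal) :
    ∫⁻ q, H q = ∑' l : Λ, ∫⁻ q in D, H ((l : E × F) + q) := by
  have := countable_lattice Λ
  have : MeasurableVAdd Λ (E × F) := (inferInstance : MeasurableVAdd Λ.toAddSubgroup (E × F))
  have : VAddInvariantMeasure Λ (E × F) volume :=
    (inferInstance : VAddInvariantMeasure Λ.toAddSubgroup (E × F) volume)
  exact hD.lintegral_eq_tsum'' H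

theorem integral_eq_tsum_lattice {Λ : Submodule ℤ (E × F)} [DiscreteTopology Λ] {D : Set (E × F)}
    (hD : IsAddFundamentalDomain Λ D (volume : Measure (E × F))) {H : E × F → ℂ}
    (hH : Integrable H) :
    ∫ q, H q = ∑' l : Λ, ∫ q in D, H ((l : E × F) + q) := by
  have := countable_lattice Λ
  have : MeasurableVAdd Λ (E × F) := (inferInstance : MeasurableVAdd Λ.toAddSubgroup (E × F))
  have : VAddInvariantMeasure Λ (E × F) volume :=
    (inferInstance : VAddInvariantMeasure Λ.toAddSubgroup (E × F) volume)
  exact hD.integral_eq_tsum'' H hH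

/-- The sum of the weights `(1 + ‖·‖)⁻ⁿ` over the lattice points above a set `A` is at most `K` times
the volume of the `ρ`-neighbourhood of `A`, uniformly in `A` and in translations of the weight. -/
def CountingBound (Λ : Submodule ℤ (E × F)) (n : ℕ) (K : NNReal) (ρ : ℝ) : Prop :=
  ∀ (A : Set E) (v : F),
    ∑' l : Λ, A.indicator (fun _ => ENNReal.ofReal (decayWeight n ((l : E × F).2 + v)))
      (l : E × F).1 ≤ K * volume (Metric.thickening ρ A)

/-- Weighted lattice point counting: the sum of the weights over the lattice points above a set is
controlled by the volume of a neighbourhood of the set, uniformly in translations of the weight. -/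
theorem exists_tsum_decayWeight_le (Λ : Submodule ℤ (E × F)) [DiscreteTopology Λ] [IsZLattice ℝ Λ]
    {n : ℕ} (hn : Module.finrank ℝ F < n) :
    ∃ K : NNReal, ∃ ρ : ℝ, 0 < ρ ∧ CountingBound Λ n K ρ := by
  obtain ⟨D, hD, hDm, hDb, -, hD0, hDt⟩ := exists_bounded_fundamentalDomain Λ
  obtain ⟨ρ, hρ, hDρ⟩ := hDb.exists_pos_norm_lt
  have hint := integrable_decayWeight (volume : Measure F) hn
  set I : ENNReal := ∫⁻ u : F, ENNReal.ofReal (decayWeight n u) with hI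
  have hIt : I ≠ ⊤ := by
    have := hint.hasFiniteIntegral
    rw [hasFiniteIntegral_iff_ofReal
      (Eventually.of_forall fun u => (decayWeight_pos n u).le)] at this
    exact this.ne
  set c : ENNReal := ENNReal.ofReal ((1 + ρ) ^ n) with hc
  have hKt : (volume D)⁻¹ * (c * I) ≠ ⊤ :=
    ENNReal.mul_ne_top (ENNReal.inv_ne_top.2 hD0) (ENNReal.mul_ne_top ENNReal.ofReal_ne_top hIt)
  refine ⟨((volume D)⁻¹ * (c * I)).toNNReal, ρ, hρ, fun A v => ?_⟩
  rw [ENNReal.coe_toNNReal hKt]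
  set T := Metric.thickening ρ A with hT
  have hTm : MeasurableSet T := Metric.isOpen_thickening.measurableSet
  -- For `l` above `A` and `q ∈ D`, the point `l + q` lies above `T`, and moving the weight by `q.2`
  -- costs at most `c`; so the term at `l` is at most `H (l + q)`. Integrating over `D` and summing
  -- unfolds to `∫ H`. Only the open set `T` is measured, so `A` can be arbitrary.
  let H : E × F → ENNReal := fun q =>
    T.indicator (fun _ => (1 : ENNReal)) q.1 * (c * ENNReal.ofReal (decayWeight n (q.2 + v)))
  have hHint : ∫⁻ q, H q = volume T * (c * I) := by
    have h1 : Measurable (T.indicator (fun _ => (1 : ENNReal))) :=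
      measurable_const.indicator hTm
    have h2 : Measurable fun u : F => c * ENNReal.ofReal (decayWeight n (u + v)) :=
      ((ENNReal.measurable_ofReal.comp ((continuous_decayWeight n).measurable.comp
        (measurable_add_const v)))).const_mul c
    have h3 := lintegral_prod_mul (μ := (volume : Measure E)) (ν := (volume : Measure F))
      h1.aemeasurable h2.aemeasurable
    refine Eq.trans h3 ?_
    rw [lintegral_indicator_const hTm, one_mul, lintegral_const_mul' _ _ ENNReal.ofReal_ne_top,
      lintegral_add_right_eq_self (fun u : F => ENNReal.ofReal (decayWeight n u)) v]
  have hle : volume D * ∑' l : Λ, A.indicator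
      (fun _ => ENNReal.ofReal (decayWeight n ((l : E × F).2 + v))) (l : E × F).1
      ≤ volume T * (c * I) := by
    rw [← hHint, lintegral_eq_tsum_lattice hD H, ← ENNReal.tsum_mul_left]
    refine ENNReal.tsum_le_tsum fun l => ?_
    by_cases hl : (l : E × F).1 ∈ A
    · rw [indicator_of_mem hl, mul_comm, ← setLIntegral_const]
      refine setLIntegral_mono' hDm fun q hq => ?_
      have hq' := hDρ q hq
      have hq1 : ‖q.1‖ < ρ := (norm_fst_le q).trans_lt hq'
      have hq2 : ‖q.2‖ < ρ := (norm_snd_le q).trans_lt hq'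
      have hmem : ((l : E × F) + q).1 ∈ T := by
        refine Metric.mem_thickening_iff.2 ⟨_, hl, ?_⟩
        rw [dist_eq_norm, Prod.fst_add, add_sub_cancel_left]
        exact hq1
      simp only [H, indicator_of_mem hmem, one_mul]
      rw [hc, ← ENNReal.ofReal_mul (by positivity)]
      refine ENNReal.ofReal_le_ofReal ?_
      have h4 := decayWeight_le_mul n ((l : E × F).2 + v) q.2
      rw [Prod.snd_add, add_right_comm]
      refine h4.trans (mul_le_mul_of_nonneg_right ?_ (decayWeight_pos n _).le)
      exact pow_le_pow_left₀ (by positivity) (by linarith) n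
    · rw [indicator_of_notMem hl, mul_zero]
      exact zero_le
  calc _ = (volume D)⁻¹ * (volume D * ∑' l : Λ, A.indicator
        (fun _ => ENNReal.ofReal (decayWeight n ((l : E × F).2 + v))) (l : E × F).1) := by
        rw [← mul_assoc, ENNReal.inv_mul_cancel hD0 hDt, one_mul]
    _ ≤ (volume D)⁻¹ * (volume T * (c * I)) := by gcongr
    _ = (volume D)⁻¹ * (c * I) * volume T := by ring

end LatticeSums

/-! ### Boundary effects for large balls. -/

section Annuli

variable {E : Type*} [NormedAddCommGroup E]

theorem thickening_subset_closedBall {A : Set E} {r ρ : ℝ} (hA : A ⊆ Metric.closedBall 0 r) :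
    Metric.thickening ρ A ⊆ Metric.closedBall 0 (r + ρ) := by
  intro x hx
  obtain ⟨y, hy, hxy⟩ := Metric.mem_thickening_iff.1 hx
  have hy' := mem_closedBall_zero_iff.1 (hA hy)
  rw [dist_eq_norm] at hxy
  rw [mem_closedBall_zero_iff]
  have := norm_add_le y (x - y)
  rw [add_sub_cancel] at this
  linarith

theorem thickening_subset_annulus {A : Set E} {r b ρ : ℝ}
    (hA : A ⊆ Metric.closedBall 0 (r + b) \ Metric.closedBall 0 (r - b)) :
    Metric.thickening ρ A ⊆
      Metric.closedBall 0 (r + (b + ρ)) \ Metric.closedBall 0 (r - (b + ρ)) := by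
  intro x hx
  refine ⟨?_, ?_⟩
  · have := thickening_subset_closedBall (hA.trans sdiff_subset) hx
    rwa [add_assoc] at this
  obtain ⟨y, hy, hxy⟩ := Metric.mem_thickening_iff.1 hx
  have hy' := (hA hy).2
  rw [dist_eq_norm] at hxy
  rw [mem_closedBall_zero_iff] at hy' ⊢
  have := norm_sub_le x (x - y)
  rw [sub_sub_cancel] at this
  linarith

theorem symmDiff_preimage_add_subset_annulus (s : E) (r : ℝ) :
    symmDiff ((fun x => x + s) ⁻¹' Metric.closedBall 0 r) (Metric.closedBall 0 r)
      ⊆ Metric.closedBall 0 (r + ‖s‖) \ Metric.closedBall 0 (r - ‖s‖) := by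
  intro x hx
  have h1 := norm_add_le x s
  have h2 := norm_sub_le (x + s) s
  rw [add_sub_cancel_right] at h2
  have h3 := norm_nonneg s
  simp only [mem_symmDiff, mem_preimage, mem_closedBall_zero_iff, Set.mem_sdiff, not_le] at hx ⊢
  rcases hx with hx | hx
  · exact ⟨by linarith, by linarith⟩
  · exact ⟨by linarith, by linarith⟩

end Annuli

section BallVolumes

variable {E : Type*} [NormedAddCommGroup E] [NormedSpace ℝ E] [FiniteDimensional ℝ E]
  [MeasureSpace E] [BorelSpace E] [(volume : Measure E).IsAddHaarMeasure]

theorem volume_real_closedBall_pos {r : ℝ} (hr : 0 < r) :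
    0 < volume.real (Metric.closedBall (0 : E) r) :=
  ENNReal.toReal_pos (Metric.measure_closedBall_pos volume 0 hr).ne' measure_closedBall_lt_top.ne

theorem tendsto_volume_closedBall_add_div (a : ℝ) :
    Tendsto (fun r : ℝ => volume.real (Metric.closedBall (0 : E) (r + a))
      / volume.real (Metric.closedBall (0 : E) r)) atTop (𝓝 1) := by
  have h1 : Tendsto (fun r : ℝ => (1 + a / r) ^ Module.finrank ℝ E) atTop (𝓝 1) := by
    have := ((tendsto_const_nhds (x := (1 : ℝ))).add
      ((tendsto_const_nhds (x := a)).div_atTop tendsto_id)).pow (Module.finrank ℝ E)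
    simpa using this
  refine h1.congr' ?_
  filter_upwards [eventually_gt_atTop 0, eventually_ge_atTop (-a)] with r hr hra
  have hc : volume.real (Metric.closedBall (0 : E) 1) ≠ 0 := (volume_real_closedBall_pos one_pos).ne'
  rw [Measure.addHaar_real_closedBall' volume (0 : E) (by linarith : 0 ≤ r + a),
    Measure.addHaar_real_closedBall' volume (0 : E) hr.le, mul_div_mul_right _ _ hc, ← div_pow,
    add_div, div_self hr.ne']

/-- The quotient is a difference of two volume ratios that both tend to `1`. This makes all boundary
corrections negligible. -/
theorem tendsto_volume_annulus_div {a : ℝ} (ha : 0 ≤ a) :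
    Tendsto (fun r : ℝ => volume.real
      (Metric.closedBall (0 : E) (r + a) \ Metric.closedBall (0 : E) (r - a))
      / volume.real (Metric.closedBall (0 : E) r)) atTop (𝓝 0) := by
  have h := (tendsto_volume_closedBall_add_div (E := E) a).sub
    (tendsto_volume_closedBall_add_div (E := E) (-a))
  rw [sub_self] at h
  refine h.congr fun r => ?_
  rw [measureReal_sdiff (Metric.closedBall_subset_closedBall (by linarith))
    Metric.isClosed_closedBall.measurableSet measure_closedBall_lt_top.ne, sub_div, sub_eq_add_neg r]

theorem eventually_volume_closedBall_add_le (a : ℝ) :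
    ∀ᶠ r : ℝ in atTop, volume.real (Metric.closedBall (0 : E) (r + a))
      ≤ 2 * volume.real (Metric.closedBall (0 : E) r) := by
  filter_upwards [(tendsto_volume_closedBall_add_div (E := E) a).eventually
    (gt_mem_nhds (by norm_num : (1 : ℝ) < 2)), eventually_gt_atTop 0] with r hr hr0
  exact ((div_lt_iff₀ (volume_real_closedBall_pos hr0)).1 hr).le

end BallVolumes

/-! ### Equidistribution of weighted lattice averages. -/

section LatticeAverages

variable {E F : Type*} [NormedAddCommGroup E] [NormedSpace ℝ E] [FiniteDimensional ℝ E]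
  [MeasureSpace E] [BorelSpace E] [(volume : Measure E).IsAddHaarMeasure]
  [NormedAddCommGroup F] [NormedSpace ℝ F] [FiniteDimensional ℝ F]
  [MeasureSpace F] [BorelSpace F] [(volume : Measure F).IsAddHaarMeasure]
  {Λ : Submodule ℤ (E × F)} {n : ℕ} {K : NNReal} {ρ : ℝ} {A A' : Set E} {G G' : F → ℂ}
  {c : ℝ} {v : F}

theorem CountingBound.tsum_lt_top (hK : CountingBound Λ n K ρ) (hA : IsBounded A) (v : F) :
    ∑' l : Λ, A.indicator (fun _ => ENNReal.ofReal (decayWeight n ((l : E × F).2 + v)))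
      (l : E × F).1 < ⊤ :=
  (hK A v).trans_lt (ENNReal.mul_lt_top ENNReal.coe_lt_top hA.thickening.measure_lt_top)

theorem CountingBound.hasSum (hK : CountingBound Λ n K ρ) (hA : IsBounded A) (v : F) :
    HasSum (fun l : Λ => A.indicator (fun _ => decayWeight n ((l : E × F).2 + v)) (l : E × F).1)
      (∑' l : Λ, A.indicator (fun _ => ENNReal.ofReal (decayWeight n ((l : E × F).2 + v)))
      (l : E × F).1).toReal := by
  have h := ENNReal.hasSum_toReal (hK.tsum_lt_top hA v).ne
  have hne := ENNReal.ne_top_of_tsum_ne_top (hK.tsum_lt_top hA v).ne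
  rw [ENNReal.tsum_toReal_eq hne]
  convert h using 2 with l
  by_cases hl : (l : E × F).1 ∈ A
  · simp [hl, (decayWeight_pos n _).le]
  · simp [hl]

theorem CountingBound.toReal_tsum_le (hK : CountingBound Λ n K ρ) (hA : IsBounded A) (v : F) :
    (∑' l : Λ, A.indicator (fun _ => ENNReal.ofReal (decayWeight n ((l : E × F).2 + v)))
      (l : E × F).1).toReal ≤ K * volume.real (Metric.thickening ρ A) := by
  have := ENNReal.toReal_mono (ENNReal.mul_ne_top ENNReal.coe_ne_top
    hA.thickening.measure_lt_top.ne) (hK A v)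
  rwa [ENNReal.toReal_mul] at this

/-- The sum of `G ∘ π₂` over the lattice points above `A`. -/
def latSum (Λ : Submodule ℤ (E × F)) (A : Set E) (G : F → ℂ) : ℂ :=
  ∑' l : Λ, A.indicator (fun _ => G (l : E × F).2) (l : E × F).1

theorem norm_indicator_le_mul (hG : ∀ u, ‖G u‖ ≤ c * decayWeight n (u + v)) (q : E × F) :
    ‖A.indicator (fun _ => G q.2) q.1‖
      ≤ c * A.indicator (fun _ => decayWeight n (q.2 + v)) q.1 := by
  by_cases hq : q.1 ∈ A <;> simp [hq, hG]

theorem CountingBound.summable (hK : CountingBound Λ n K ρ) (hA : IsBounded A)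
    (hG : ∀ u, ‖G u‖ ≤ c * decayWeight n (u + v)) :
    Summable fun l : Λ => A.indicator (fun _ => G (l : E × F).2) (l : E × F).1 :=
  Summable.of_norm_bounded ((hK.hasSum hA v).summable.mul_left c)
    fun _ => norm_indicator_le_mul hG _

theorem CountingBound.norm_latSum_le (hK : CountingBound Λ n K ρ) (hA : IsBounded A) (hc : 0 ≤ c)
    (hG : ∀ u, ‖G u‖ ≤ c * decayWeight n (u + v)) :
    ‖latSum Λ A G‖ ≤ c * (K * volume.real (Metric.thickening ρ A)) :=
  (tsum_of_norm_bounded ((hK.hasSum hA v).mul_left c)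
    fun _ => norm_indicator_le_mul hG _).trans
    (mul_le_mul_of_nonneg_left (hK.toReal_tsum_le hA v) hc)

theorem CountingBound.norm_latSum_sub_le (hK : CountingBound Λ n K ρ) (hA : IsBounded A)
    (hA' : IsBounded A') (hc : 0 ≤ c) (hG : ∀ u, ‖G u‖ ≤ c * decayWeight n (u + v)) :
    ‖latSum Λ A G - latSum Λ A' G‖
      ≤ c * (K * volume.real (Metric.thickening ρ (symmDiff A A'))) := by
  have hS : IsBounded (symmDiff A A') := (hA.union hA').subset symmDiff_subset_union
  rw [latSum, latSum, ← (hK.summable hA hG).tsum_sub (hK.summable hA' hG)]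
  refine (tsum_of_norm_bounded ((hK.hasSum hS v).mul_left c) fun l => ?_).trans
    (mul_le_mul_of_nonneg_left (hK.toReal_tsum_le hS v) hc)
  refine le_trans (le_of_eq ?_) (norm_indicator_le_mul hG _)
  by_cases h1 : (l : E × F).1 ∈ A <;> by_cases h2 : (l : E × F).1 ∈ A' <;>
    simp [h1, h2, mem_symmDiff]

theorem CountingBound.latSum_sub (hK : CountingBound Λ n K ρ) (hA : IsBounded A) {c' : ℝ} {v' : F}
    (hG : ∀ u, ‖G u‖ ≤ c * decayWeight n (u + v))
    (hG' : ∀ u, ‖G' u‖ ≤ c' * decayWeight n (u + v')) :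
    latSum Λ A G - latSum Λ A G' = latSum Λ A (fun u => G u - G' u) := by
  rw [latSum, latSum, ← (hK.summable hA hG).tsum_sub (hK.summable hA hG')]
  refine tsum_congr fun l => ?_
  by_cases h1 : (l : E × F).1 ∈ A <;> simp [h1]

/-- Shifting the summation index by `l'` shows that the translation `(s, v)` matters only modulo the
lattice. -/
theorem latSum_translate (l' : Λ) (s : E) (v : F) :
    latSum Λ ((fun x => x + s) ⁻¹' A) (fun u => G (u + v))
      = latSum Λ ((fun x => x + (s - (l' : E × F).1)) ⁻¹' A)
        (fun u => G (u + (v - (l' : E × F).2))) := by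
  rw [latSum, latSum]
  refine Eq.trans ?_ ((Equiv.addRight l').tsum_eq _)
  refine tsum_congr fun l => ?_
  simp only [Equiv.coe_addRight, Submodule.coe_add, Prod.fst_add, Prod.snd_add]
  have h1 : (l : E × F).1 + (l' : E × F).1 + (s - (l' : E × F).1) = (l : E × F).1 + s := by abel
  have h2 : (l : E × F).2 + (l' : E × F).2 + (v - (l' : E × F).2) = (l : E × F).2 + v := by abel
  by_cases h : (l : E × F).1 + s ∈ A <;> simp [indicator, h1, h2, h]

/-- Changing the averaging balls near their boundary does not change the averages. -/
theorem CountingBound.tendsto_latSum_sub (hK : CountingBound Λ n K ρ) (hρ : 0 < ρ) {A : ℝ → Set E}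
    {b : ℝ} (hb : 0 ≤ b)
    (hA : ∀ r, symmDiff (A r) (Metric.closedBall 0 r)
      ⊆ Metric.closedBall 0 (r + b) \ Metric.closedBall 0 (r - b))
    (hc : 0 ≤ c) (hG : ∀ u, ‖G u‖ ≤ c * decayWeight n (u + v)) :
    Tendsto (fun r : ℝ => ((volume.real (Metric.closedBall (0 : E) r))⁻¹ : ℂ)
      * (latSum Λ (A r) G - latSum Λ (Metric.closedBall 0 r) G)) atTop (𝓝 0) := by
  have hbd : ∀ r, IsBounded (A r) := fun r => by
    refine (Metric.isBounded_closedBall (x := (0 : E)) (r := r + b)).subset fun x hx => ?_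
    by_cases hx' : x ∈ Metric.closedBall 0 r
    · exact Metric.closedBall_subset_closedBall (by linarith) hx'
    · exact (hA r (mem_symmDiff.2 (Or.inl ⟨hx, hx'⟩))).1
  have h0 := ((tendsto_volume_annulus_div (E := E) (add_nonneg hb hρ.le)).const_mul (c * K))
  rw [mul_zero] at h0
  refine squeeze_zero_norm (fun r => ?_) h0
  rw [norm_mul, norm_inv, Complex.norm_of_nonneg measureReal_nonneg]
  have h1 := hK.norm_latSum_sub_le (hbd r) (Metric.isBounded_closedBall (x := (0 : E)) (r := r)) hc hG
  have h2 : volume.real (Metric.thickening ρ (symmDiff (A r) (Metric.closedBall 0 r)))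
      ≤ volume.real (Metric.closedBall (0 : E) (r + (b + ρ)) \ Metric.closedBall 0 (r - (b + ρ))) :=
    measureReal_mono (thickening_subset_annulus (hA r))
      ((measure_mono sdiff_subset).trans_lt measure_closedBall_lt_top).ne
  calc _ ≤ (volume.real (Metric.closedBall (0 : E) r))⁻¹ * (c * (K * volume.real
        (Metric.closedBall (0 : E) (r + (b + ρ)) \ Metric.closedBall 0 (r - (b + ρ))))) := by
        refine mul_le_mul_of_nonneg_left (h1.trans ?_) (inv_nonneg.2 measureReal_nonneg)
        gcongr
    _ = _ := by rw [div_eq_mul_inv]; ring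

/-- The bound does not depend on `v`, so it serves as the dominating constant over a fundamental
domain. -/
theorem CountingBound.norm_inv_mul_latSum_le (hK : CountingBound Λ n K ρ) (hc : 0 ≤ c)
    {r a : ℝ} (hr : 0 < r) (hA : A ⊆ Metric.closedBall 0 (r + a))
    (hr' : volume.real (Metric.closedBall (0 : E) (r + (a + ρ)))
      ≤ 2 * volume.real (Metric.closedBall (0 : E) r))
    (hG : ∀ u, ‖G u‖ ≤ c * decayWeight n (u + v)) :
    ‖((volume.real (Metric.closedBall (0 : E) r))⁻¹ : ℂ) * latSum Λ A G‖ ≤ 2 * (c * K) := by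
  rw [norm_mul, norm_inv, Complex.norm_of_nonneg measureReal_nonneg]
  have hV := volume_real_closedBall_pos (E := E) hr
  rw [inv_mul_le_iff₀ hV]
  refine (hK.norm_latSum_le (Metric.isBounded_closedBall.subset hA) hc hG).trans ?_
  have h2 : volume.real (Metric.thickening ρ A) ≤ 2 * volume.real (Metric.closedBall (0 : E) r) := by
    refine le_trans (measureReal_mono ((thickening_subset_closedBall hA).trans ?_)
      measure_closedBall_lt_top.ne) hr'
    rw [add_assoc]
  calc c * (K * volume.real (Metric.thickening ρ A))
      ≤ c * (K * (2 * volume.real (Metric.closedBall (0 : E) r))) := by gcongr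
    _ = _ := by ring

/-- Averages of translates of `G` over the lattice points above large balls are asymptotically
independent of the translation. -/
theorem CountingBound.tendsto_latSum_translate_sub (hK : CountingBound Λ n K ρ) (hρ : 0 < ρ)
    (hdense : Dense (Prod.snd '' (Λ : Set (E × F)))) (hGc : Continuous G) (hc : 0 ≤ c)
    (hG : ∀ u, ‖G u‖ ≤ c * decayWeight n u)
    (hlim : Tendsto (fun u => ‖G u‖ / decayWeight n u) (cocompact F) (𝓝 0)) (s : E) (v : F) :
    Tendsto (fun r : ℝ => ((volume.real (Metric.closedBall (0 : E) r))⁻¹ : ℂ)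
      * (latSum Λ ((fun x => x + s) ⁻¹' Metric.closedBall 0 r) (fun u => G (u + v))
        - latSum Λ (Metric.closedBall 0 r) G)) atTop (𝓝 0) := by
  rw [Metric.tendsto_nhds]
  intro ε hε
  -- With this constant the averaged change of `G` is at most `ε / 2 * (K / (K + 1)) < ε / 2`; using
  -- `K + 1` covers `K = 0`.
  obtain ⟨δ, hδ, hδG⟩ := exists_norm_sub_le_mul_decayWeight hGc hlim
    (show 0 < ε / (2 * (2 * (K + 1))) by positivity)
  -- Density makes the internal shift `w` small, at the price of a possibly large but fixed shift
  -- `t` of the ball.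
  obtain ⟨_, ⟨l, hl, rfl⟩, hlv⟩ := hdense.exists_dist_lt v hδ
  rw [dist_eq_norm] at hlv
  set w := v - l.2 with hw
  set t := s - l.1 with ht
  have hG0 : ∀ u, ‖G u‖ ≤ c * decayWeight n (u + 0) := by simpa using hG
  have h1 := hK.tendsto_latSum_sub (A := fun r => (fun x => x + t) ⁻¹' Metric.closedBall 0 r) hρ
    (norm_nonneg t) (symmDiff_preimage_add_subset_annulus t) hc hG0
  rw [Metric.tendsto_nhds] at h1
  filter_upwards [h1 (ε / 2) (half_pos hε), eventually_gt_atTop 0,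
    eventually_volume_closedBall_add_le (E := E) (‖t‖ + ρ)] with r hr1 hr0 hr2
  have hsub : (fun x : E => x + t) ⁻¹' Metric.closedBall 0 r ⊆ Metric.closedBall 0 (r + ‖t‖) := by
    intro x hx
    simp only [mem_preimage, mem_closedBall_zero_iff] at hx ⊢
    have h2 := norm_sub_le (x + t) t
    rw [add_sub_cancel_right] at h2
    linarith
  have hbd := Metric.isBounded_closedBall.subset hsub
  -- First the function changes over a fixed set, then the set changes for a fixed function.
  have h3 : latSum Λ ((fun x => x + s) ⁻¹' Metric.closedBall 0 r) (fun u => G (u + v))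
      - latSum Λ (Metric.closedBall 0 r) G
      = latSum Λ ((fun x => x + t) ⁻¹' Metric.closedBall 0 r) (fun u => G (u + w) - G u)
        + (latSum Λ ((fun x => x + t) ⁻¹' Metric.closedBall 0 r) G
          - latSum Λ (Metric.closedBall 0 r) G) := by
    rw [latSum_translate ⟨l, hl⟩, ← hK.latSum_sub hbd (fun u => hG (u + w)) hG0]
    ring
  have hK1 : (0 : ℝ) ≤ K := K.2
  have h4 := hK.norm_inv_mul_latSum_le (v := (0 : F)) (by positivity) hr0 hsub hr2
    (G := fun u => G (u + w) - G u) (c := ε / (2 * (2 * (K + 1))))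
    (fun u => by simpa using hδG w hlv u)
  have h5 : 2 * (ε / (2 * (2 * ((K : ℝ) + 1))) * K) < ε / 2 := by
    have : 2 * (ε / (2 * (2 * ((K : ℝ) + 1))) * K) = ε / 2 * (K / (K + 1)) := by
      field_simp
    rw [this]
    have h6 : (K : ℝ) / (K + 1) < 1 := by rw [div_lt_one (by positivity)]; linarith
    nlinarith
  rw [dist_zero_right] at hr1 ⊢
  rw [h3, mul_add]
  refine (norm_add_le _ _).trans_lt ?_
  linarith

theorem integrable_of_le_decayWeight (hn : Module.finrank ℝ F < n) (hGc : Continuous G)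
    (hG : ∀ u, ‖G u‖ ≤ c * decayWeight n u) : Integrable G :=
  ((integrable_decayWeight volume hn).const_mul c).mono' hGc.aestronglyMeasurable
    (Eventually.of_forall hG)

/-- The translated sum is the periodization of `1_{B_r} ⊗ G`, so its integral over `D` unfolds to
the full integral, which factors by Fubini. -/
theorem CountingBound.setIntegral_latSum [DiscreteTopology Λ] (hK : CountingBound Λ n K ρ)
    (hn : Module.finrank ℝ F < n) {D : Set (E × F)}
    (hD : IsAddFundamentalDomain Λ D (volume : Measure (E × F)))
    (hGc : Continuous G) (hG : ∀ u, ‖G u‖ ≤ c * decayWeight n u) (r : ℝ) :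
    StronglyMeasurable (fun q : E × F => latSum Λ ((fun x => x + q.1) ⁻¹' Metric.closedBall 0 r)
      (fun u => G (u + q.2))) ∧
    ∫ q in D, latSum Λ ((fun x => x + q.1) ⁻¹' Metric.closedBall 0 r) (fun u => G (u + q.2))
      = volume.real (Metric.closedBall (0 : E) r) * ∫ u, G u := by
  have := countable_lattice Λ
  have hBm : MeasurableSet (Metric.closedBall (0 : E) r) := Metric.isClosed_closedBall.measurableSet
  let H : E × F → ℂ := fun q =>
    (Metric.closedBall (0 : E) r).indicator (fun _ => (1 : ℂ)) q.1 * G q.2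
  have hHm : Measurable H :=
    ((measurable_const.indicator hBm).comp measurable_fst).mul (hGc.measurable.comp measurable_snd)
  have hHi : Integrable H := by
    refine Integrable.mul_prod (f := (Metric.closedBall (0 : E) r).indicator fun _ => (1 : ℂ))
      (g := G) ?_ (integrable_of_le_decayWeight hn hGc hG)
    exact (integrableOn_const measure_closedBall_lt_top.ne).integrable_indicator hBm
  have hterm : ∀ (q : E × F) (l : Λ),
      ((fun x => x + q.1) ⁻¹' Metric.closedBall 0 r).indicator
        (fun _ => G ((l : E × F).2 + q.2)) (l : E × F).1 = H ((l : E × F) + q) := by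
    intro q l
    by_cases h : (l : E × F).1 + q.1 ∈ Metric.closedBall 0 r
    · simp only [H, indicator, mem_preimage, Prod.fst_add, Prod.snd_add, h, if_true, one_mul]
    · simp only [H, indicator, mem_preimage, Prod.fst_add, Prod.snd_add, h, if_false, zero_mul]
  have hsum : ∀ q : E × F, latSum Λ ((fun x => x + q.1) ⁻¹' Metric.closedBall 0 r)
      (fun u => G (u + q.2)) = ∑' l : Λ, H ((l : E × F) + q) := fun q => by
    rw [latSum]
    exact tsum_congr fun l => hterm q l
  have hHl : ∀ l : Λ, StronglyMeasurable fun q => H ((l : E × F) + q) := fun l =>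
    (hHm.comp (measurable_const_add _)).stronglyMeasurable
  simp_rw [hsum]
  refine ⟨StronglyMeasurable.hasSum (L := .unconditional Λ) hHl fun q => ?_, ?_⟩
  · have hb : IsBounded ((fun x : E => x + q.1) ⁻¹' Metric.closedBall 0 r) := by
      refine (Metric.isBounded_closedBall (x := (0 : E)) (r := r + ‖q.1‖)).subset fun x hx => ?_
      simp only [mem_preimage, mem_closedBall_zero_iff] at hx ⊢
      have h2 := norm_sub_le (x + q.1) q.1
      rw [add_sub_cancel_right] at h2
      linarith
    have hs := hK.summable hb (G := fun u => G (u + q.2)) (v := q.2) (fun u => hG (u + q.2))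
    simp_rw [hterm q] at hs
    exact hs.hasSum
  · rw [integral_tsum (fun l => (hHl l).aestronglyMeasurable), ← integral_eq_tsum_lattice hD hHi]
    · refine (integral_prod_mul (μ := (volume : Measure E)) (ν := (volume : Measure F))
        ((Metric.closedBall (0 : E) r).indicator fun _ => (1 : ℂ)) G).trans ?_
      rw [integral_indicator_const _ hBm]
      simp
    · rw [← lintegral_eq_tsum_lattice hD (fun q => ‖H q‖ₑ)]
      exact hHi.hasFiniteIntegral.ne

/-- Equidistribution: the averages of `G ∘ π₂` over the lattice points above large balls converge
to the mean of `G` with respect to the density of the lattice. -/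
theorem CountingBound.tendsto_latSum [DiscreteTopology Λ] [IsZLattice ℝ Λ]
    (hK : CountingBound Λ n K ρ) (hρ : 0 < ρ) (hn : Module.finrank ℝ F < n)
    (hdense : Dense (Prod.snd '' (Λ : Set (E × F)))) (hGc : Continuous G) (hc : 0 ≤ c)
    (hG : ∀ u, ‖G u‖ ≤ c * decayWeight n u)
    (hlim : Tendsto (fun u => ‖G u‖ / decayWeight n u) (cocompact F) (𝓝 0)) :
    Tendsto (fun r : ℝ => ((volume.real (Metric.closedBall (0 : E) r))⁻¹ : ℂ)
      * latSum Λ (Metric.closedBall 0 r) G) atTop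
      (𝓝 ((ZLattice.covolume Λ volume : ℂ)⁻¹ * ∫ u, G u)) := by
  obtain ⟨D, hD, hDm, hDb, hDcov, hD0, hDt⟩ := exists_bounded_fundamentalDomain Λ
  obtain ⟨b, hb, hDb'⟩ := hDb.exists_pos_norm_lt
  have hfin : IsFiniteMeasure (volume.restrict D : Measure (E × F)) :=
    ⟨by rw [Measure.restrict_apply_univ]; exact hDt.lt_top⟩
  set V : ℝ → ℂ := fun r => ((volume.real (Metric.closedBall (0 : E) r) : ℂ))⁻¹ with hV
  let a : ℝ → E × F → ℂ := fun r q =>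
    latSum Λ ((fun x => x + q.1) ⁻¹' Metric.closedBall 0 r) (fun u => G (u + q.2))
  have hG0 : ∀ u, ‖G u‖ ≤ c * decayWeight n (u + 0) := by simpa using hG
  have ha : ∀ᶠ r : ℝ in atTop, ∀ q ∈ D, ‖V r * a r q‖ ≤ 2 * (c * K) := by
    filter_upwards [eventually_gt_atTop 0,
      eventually_volume_closedBall_add_le (E := E) (b + ρ)] with r hr0 hr q hq
    refine hK.norm_inv_mul_latSum_le (v := q.2) hc hr0 (fun x hx => ?_) hr fun u => hG (u + q.2)
    simp only [mem_preimage, mem_closedBall_zero_iff] at hx ⊢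
    have h2 := norm_sub_le (x + q.1) q.1
    rw [add_sub_cancel_right] at h2
    linarith [(norm_fst_le q).trans_lt (hDb' q hq)]
  have h0 : ∀ᶠ r : ℝ in atTop, ‖V r * latSum Λ (Metric.closedBall 0 r) G‖ ≤ 2 * (c * K) := by
    filter_upwards [eventually_gt_atTop 0,
      eventually_volume_closedBall_add_le (E := E) (0 + ρ)] with r hr0 hr
    exact hK.norm_inv_mul_latSum_le hc hr0 (by rw [add_zero]) hr hG0
  -- Pointwise in `q` the integrand tends to `0` by asymptotic translation invariance, and it is
  -- eventually bounded by a constant on `D`.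
  have hdct : Tendsto (fun r => ∫ q in D, V r * (a r q - latSum Λ (Metric.closedBall 0 r) G))
      atTop (𝓝 (∫ q in D, (0 : ℂ))) := by
    refine tendsto_integral_filter_of_dominated_convergence (fun _ => 2 * (c * K) + 2 * (c * K))
      ?_ ?_ (integrable_const _) ?_
    · refine Eventually.of_forall fun r => ?_
      exact (((hK.setIntegral_latSum hn hD hGc hG r).1.sub stronglyMeasurable_const).const_mul
        (V r)).aestronglyMeasurable
    · filter_upwards [ha, h0] with r hr hr0
      refine (ae_restrict_iff' hDm).2 (Eventually.of_forall fun q hq => ?_)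
      rw [mul_sub]
      exact (norm_sub_le _ _).trans (add_le_add (hr q hq) hr0)
    · refine Eventually.of_forall fun q => ?_
      exact hK.tendsto_latSum_translate_sub hρ hdense hGc hc hG hlim q.1 q.2
  rw [integral_zero] at hdct
  have hcov : (ZLattice.covolume Λ volume : ℂ) ≠ 0 := by
    exact_mod_cast ZLattice.covolume_ne_zero Λ volume
  -- Unfolding makes the translated part exactly `∫ G` for large `r`, so the vanishing of the left
  -- side determines the limit of the averages.
  have hev : ∀ᶠ r : ℝ in atTop, ∫ q in D, V r * (a r q - latSum Λ (Metric.closedBall 0 r) G)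
      = (∫ u, G u) - (ZLattice.covolume Λ volume : ℂ)
        * (V r * latSum Λ (Metric.closedBall 0 r) G) := by
    filter_upwards [eventually_gt_atTop 0, ha] with r hr0 hr
    have hVr : (volume.real (Metric.closedBall (0 : E) r) : ℂ) ≠ 0 := by
      exact_mod_cast (volume_real_closedBall_pos (E := E) hr0).ne'
    have hai : Integrable (fun q => V r * a r q) (volume.restrict D) :=
      Integrable.of_bound (((hK.setIntegral_latSum hn hD hGc hG r).1.const_mul
        (V r)).aestronglyMeasurable) (2 * (c * K))
        ((ae_restrict_iff' hDm).2 (Eventually.of_forall hr))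
    simp_rw [mul_sub]
    rw [integral_sub hai (integrable_const _), integral_const_mul,
      (hK.setIntegral_latSum hn hD hGc hG r).2, integral_const, ← mul_assoc, hV]
    simp only
    rw [inv_mul_cancel₀ hVr, one_mul, measureReal_restrict_apply_univ, hDcov]
    simp
  have h1 := ((hdct.congr' hev).const_sub (∫ u, G u)).const_mul (ZLattice.covolume Λ volume : ℂ)⁻¹
  rw [sub_zero] at h1
  refine h1.congr fun r => ?_
  rw [sub_sub_cancel, ← mul_assoc, inv_mul_cancel₀ hcov, one_mul]

end LatticeAverages

/-! ### Decay of `f` and of its correlations. -/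

section Decay

variable {F : Type*} [NormedAddCommGroup F]

theorem one_add_norm_pow_mul_rpow_le {n : ℕ} {α : ℝ} {u : F} (hu : 1 ≤ ‖u‖) :
    (1 + ‖u‖) ^ n * ‖u‖ ^ α ≤ 2 ^ n * ‖u‖ ^ ((n : ℝ) + α) := by
  have hu0 : 0 < ‖u‖ := one_pos.trans_le hu
  rw [Real.rpow_add hu0, Real.rpow_natCast, ← mul_assoc, ← mul_pow]
  refine mul_le_mul_of_nonneg_right (pow_le_pow_left₀ (by positivity) (by linarith) n)
    (by positivity)

theorem norm_div_decayWeight_le {n : ℕ} {α C : ℝ} {f : F → ℂ}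
    (hdecay : ∀ x, ‖x‖ ^ ((n : ℝ) + α) * ‖f x‖ ≤ C) {u : F} (hu : 1 ≤ ‖u‖) :
    ‖f u‖ / decayWeight n u ≤ 2 ^ n * C * ‖u‖ ^ (-α) := by
  have hu0 : 0 < ‖u‖ := one_pos.trans_le hu
  rw [decayWeight, div_inv_eq_mul, Real.rpow_neg hu0.le, ← div_eq_mul_inv,
    le_div_iff₀ (by positivity)]
  calc ‖f u‖ * (1 + ‖u‖) ^ n * ‖u‖ ^ α = (1 + ‖u‖) ^ n * ‖u‖ ^ α * ‖f u‖ := by ring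
    _ ≤ 2 ^ n * ‖u‖ ^ ((n : ℝ) + α) * ‖f u‖ :=
      mul_le_mul_of_nonneg_right (one_add_norm_pow_mul_rpow_le hu) (norm_nonneg _)
    _ = 2 ^ n * (‖u‖ ^ ((n : ℝ) + α) * ‖f u‖) := by ring
    _ ≤ 2 ^ n * C := mul_le_mul_of_nonneg_left (hdecay u) (by positivity)

/-- Here the surplus exponent `α` is spent: it turns `O` into `o`, as uniform continuity relative to
the weight requires. -/
theorem tendsto_norm_div_decayWeight [ProperSpace F] {n : ℕ} {α C : ℝ} (hα : 0 < α) {f : F → ℂ}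
    (hdecay : ∀ x, ‖x‖ ^ ((n : ℝ) + α) * ‖f x‖ ≤ C) :
    Tendsto (fun u => ‖f u‖ / decayWeight n u) (cocompact F) (𝓝 0) := by
  have h1 : Tendsto (fun u : F => ‖u‖) (cocompact F) atTop := tendsto_norm_cocompact_atTop
  have h2 := ((tendsto_rpow_neg_atTop hα).comp h1).const_mul (2 ^ n * C)
  rw [mul_zero] at h2
  refine squeeze_zero' (Eventually.of_forall fun u =>
    div_nonneg (norm_nonneg _) (decayWeight_pos n u).le) ?_ h2
  filter_upwards [h1.eventually (eventually_ge_atTop 1)] with u hu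
  exact norm_div_decayWeight_le hdecay hu

theorem exists_norm_le_mul_decayWeight [ProperSpace F] {n : ℕ} {α C : ℝ} (hα : 0 < α)
    {f : F → ℂ} (hf : Continuous f) (hdecay : ∀ x, ‖x‖ ^ ((n : ℝ) + α) * ‖f x‖ ≤ C) :
    ∃ c : ℝ, 0 ≤ c ∧ ∀ u, ‖f u‖ ≤ c * decayWeight n u := by
  have hcont : Continuous fun u => ‖f u‖ / decayWeight n u :=
    hf.norm.div (continuous_decayWeight n) fun u => (decayWeight_pos n u).ne'
  obtain ⟨M, hM⟩ := (isCompact_closedBall (0 : F) 1).exists_bound_of_continuousOn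
    hcont.continuousOn
  refine ⟨max |M| (2 ^ n * |C|), le_max_of_le_left (abs_nonneg M), fun u => ?_⟩
  rw [← div_le_iff₀ (decayWeight_pos n u)]
  rcases le_total ‖u‖ 1 with hu | hu
  · exact (le_abs_self _).trans (((hM u (mem_closedBall_zero_iff.2 hu)).trans
      (le_abs_self M)).trans (le_max_left _ _))
  · refine (norm_div_decayWeight_le hdecay hu).trans (le_trans ?_ (le_max_right _ _))
    have h1 : ‖u‖ ^ (-α) ≤ 1 := Real.rpow_le_one_of_one_le_of_nonpos hu (by linarith)
    have h2 : 0 ≤ ‖u‖ ^ (-α) := by positivity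
    have h3 : 2 ^ n * C ≤ 2 ^ n * |C| := mul_le_mul_of_nonneg_left (le_abs_self C) (by positivity)
    have h4 : (0 : ℝ) ≤ 2 ^ n * |C| := by positivity
    nlinarith

/-- The product `u ↦ f(u) conj (f(u - v))` whose integral is the autocorrelation of `f`. -/
def corrFun (f : F → ℂ) (v : F) : F → ℂ := fun u => f u * starRingEnd ℂ (f (u - v))

variable {f : F → ℂ} {n : ℕ} {c : ℝ}

theorem continuous_corrFun (hf : Continuous f) (v : F) : Continuous (corrFun f v) :=
  hf.mul (Complex.continuous_conj.comp (hf.comp (continuous_id.sub continuous_const)))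

theorem norm_corrFun (v u : F) : ‖corrFun f v u‖ = ‖f u‖ * ‖f (u - v)‖ := by
  rw [corrFun, norm_mul, RCLike.norm_conj]

theorem norm_corrFun_le (hc : 0 ≤ c) (hf : ∀ u, ‖f u‖ ≤ c * decayWeight n u) (v u : F) :
    ‖corrFun f v u‖ ≤ c * c * decayWeight n u := by
  rw [norm_corrFun]
  have h1 : ‖f (u - v)‖ ≤ c :=
    (hf _).trans (mul_le_of_le_one_right hc (decayWeight_le_one n _))
  calc ‖f u‖ * ‖f (u - v)‖ ≤ (c * decayWeight n u) * c :=
        mul_le_mul (hf u) h1 (norm_nonneg _) (mul_nonneg hc (decayWeight_pos n u).le)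
    _ = _ := by ring

/-- Unlike `norm_corrFun_le`, which suffices for a fixed shift, this bound decays in `v` and so
permits summation over shifts. -/
theorem norm_corrFun_le_mul_add (hc : 0 ≤ c) (hf : ∀ u, ‖f u‖ ≤ c * decayWeight n u) (v u : F) :
    ‖corrFun f v u‖
      ≤ c * c * 2 ^ n * decayWeight n v * (decayWeight n u + decayWeight n (u - v)) := by
  rw [norm_corrFun]
  calc ‖f u‖ * ‖f (u - v)‖ ≤ (c * decayWeight n u) * (c * decayWeight n (u - v)) :=
        mul_le_mul (hf u) (hf _) (norm_nonneg _) (mul_nonneg hc (decayWeight_pos n u).le)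
    _ = c * c * (decayWeight n u * decayWeight n (u - v)) := by ring
    _ ≤ c * c * (2 ^ n * decayWeight n v * (decayWeight n u + decayWeight n (u - v))) :=
      mul_le_mul_of_nonneg_left (decayWeight_mul_le n u v) (mul_nonneg hc hc)
    _ = _ := by ring

theorem tendsto_corrFun_div_decayWeight (hc : 0 ≤ c) (hf : ∀ u, ‖f u‖ ≤ c * decayWeight n u)
    (hlim : Tendsto (fun u => ‖f u‖ / decayWeight n u) (cocompact F) (𝓝 0)) (v : F) :
    Tendsto (fun u => ‖corrFun f v u‖ / decayWeight n u) (cocompact F) (𝓝 0) := by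
  have h := hlim.mul_const c
  rw [zero_mul] at h
  refine squeeze_zero (fun u => div_nonneg (norm_nonneg _) (decayWeight_pos n u).le)
    (fun u => ?_) h
  rw [norm_corrFun, div_mul_eq_mul_div]
  have h1 : ‖f (u - v)‖ ≤ c :=
    (hf _).trans (mul_le_of_le_one_right hc (decayWeight_le_one n _))
  have := decayWeight_pos n u
  gcongr

end Decay

/-! ### Positivity of autocorrelations. -/

section PositiveDefiniteness

variable {E : Type*} [NormedAddCommGroup E] [NormedSpace ℝ E] [FiniteDimensional ℝ E]
  [MeasureSpace E] [BorelSpace E] [(volume : Measure E).IsAddHaarMeasure] {g : E → ℂ}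

theorem continuous_tildeFun (hg : Continuous g) : Continuous (tildeFun g) :=
  Complex.continuous_conj.comp (hg.comp continuous_neg)

theorem hasCompactSupport_tildeFun (hg : HasCompactSupport g) : HasCompactSupport (tildeFun g) :=
  (hg.comp_homeomorph (Homeomorph.neg E)).comp_left (map_zero _)

theorem convolution_tildeFun_sub (x y : E) :
    convolution g (tildeFun g) (ContinuousLinearMap.mul ℝ ℂ) volume (x - y)
      = ∫ t, g (t + x) * starRingEnd ℂ (g (t + y)) := by
  rw [convolution, ← integral_add_right_eq_self _ x]
  refine integral_congr_ae (Eventually.of_forall fun t => ?_)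
  simp only [tildeFun, ContinuousLinearMap.mul_apply']
  congr 3
  abel

/-- The set of nonnegative real numbers in `ℂ`. -/
def nonnegReals : Set ℂ := {z | 0 ≤ z.re ∧ z.im = 0}

theorem isClosed_nonnegReals : IsClosed nonnegReals :=
  (isClosed_le continuous_const Complex.continuous_re).inter
    (isClosed_eq Complex.continuous_im continuous_const)

/-- Since `(g ∗ g̃)(x - y)` is an inner product of translates of `g`, the sum equals `∫ |∑ w i * g
(t + x i)|² dt`. -/
theorem sum_convolution_tildeFun_mem (hg : Continuous g) (hg' : HasCompactSupport g) {ι : Type*}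
    (s : Finset ι) (x : ι → E) (w : ι → ℂ) :
    ∑ p ∈ s ×ˢ s, convolution g (tildeFun g) (ContinuousLinearMap.mul ℝ ℂ) volume (x p.1 - x p.2)
      * (w p.1 * starRingEnd ℂ (w p.2)) ∈ nonnegReals := by
  have hint : ∀ p : ι × ι, Integrable fun t =>
      g (t + x p.1) * starRingEnd ℂ (g (t + x p.2)) * (w p.1 * starRingEnd ℂ (w p.2)) := fun p => by
    refine Integrable.mul_const (Continuous.integrable_of_hasCompactSupport ?_ ?_) _
    · exact (hg.comp (continuous_add_const _)).mul
        (Complex.continuous_conj.comp (hg.comp (continuous_add_const _)))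
    · exact (hg'.comp_homeomorph (Homeomorph.addRight (x p.1))).mul_right
  have h1 : ∑ p ∈ s ×ˢ s, convolution g (tildeFun g) (ContinuousLinearMap.mul ℝ ℂ) volume
      (x p.1 - x p.2) * (w p.1 * starRingEnd ℂ (w p.2))
      = ∫ t, ((Complex.normSq (∑ i ∈ s, w i * g (t + x i)) : ℝ) : ℂ) := by
    simp_rw [convolution_tildeFun_sub, ← integral_mul_const]
    rw [← integral_finsetSum _ fun p _ => hint p]
    refine integral_congr_ae (Eventually.of_forall fun t => ?_)
    simp only
    rw [← Complex.mul_conj, map_sum, Finset.sum_mul_sum, Finset.sum_product]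
    refine Finset.sum_congr rfl fun i _ => Finset.sum_congr rfl fun j _ => ?_
    rw [map_mul]
    ring
  rw [h1, integral_complex_ofReal]
  exact ⟨by simpa using integral_nonneg fun t => Complex.normSq_nonneg _, Complex.ofReal_im _⟩

theorem IsAtomic.integral_convolution_tildeFun_mem {ν : ComplexMeasure E} {ι : Type*}
    {x : ι → E} {w : ι → ℂ} {a : ℝ} (ha : 0 ≤ a)
    (h : IsAtomic ν (fun p : ι × ι => x p.1 - x p.2)
      (fun p => (a : ℂ) * (w p.1 * starRingEnd ℂ (w p.2))))
    (hg : Continuous g) (hg' : HasCompactSupport g) :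
    ∫ᵛ y, convolution g (tildeFun g) (ContinuousLinearMap.mul ℝ ℂ) volume y
      ∂[ContinuousLinearMap.mul ℝ ℂ; ν] ∈ nonnegReals := by
  set k := convolution g (tildeFun g) (ContinuousLinearMap.mul ℝ ℂ) volume with hk
  have hkc : Continuous k := (hasCompactSupport_tildeFun hg').continuous_convolution_right _
    hg.locallyIntegrable (continuous_tildeFun hg)
  have hks : HasCompactSupport k := hg'.convolution _ (hasCompactSupport_tildeFun hg')
  obtain ⟨C, hC⟩ := hkc.bounded_above_of_compact_support hks
  have h1 := h.hasSum_integral hkc.stronglyMeasurable hC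
  rw [HasSum, SummationFilter.unconditional_filter] at h1
  -- The sum over pairs may be taken along squares `s ×ˢ s`, on which partial sums are nonnegative.
  have hdiag : Tendsto (fun s : Finset ι => (s, s)) atTop atTop := by
    rw [← prod_atTop_atTop_eq]
    exact tendsto_id.prodMk tendsto_id
  have h2 := h1.comp (Filter.tendsto_finsetProd_atTop.comp hdiag)
  refine isClosed_nonnegReals.mem_of_tendsto h2 (Eventually.of_forall fun s => ?_)
  have h3 := sum_convolution_tildeFun_mem hg hg' s x w
  rw [← hk] at h3
  have h4 : ∑ p ∈ s ×ˢ s, k (x p.1 - x p.2) * ((a : ℂ) * (w p.1 * starRingEnd ℂ (w p.2)))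
      = a * ∑ p ∈ s ×ˢ s, k (x p.1 - x p.2) * (w p.1 * starRingEnd ℂ (w p.2)) := by
    rw [Finset.mul_sum]
    exact Finset.sum_congr rfl fun p _ => by ring
  simp only [Function.comp_apply]
  rw [h4]
  exact ⟨by rw [Complex.re_ofReal_mul]; exact mul_nonneg ha h3.1,
    by rw [Complex.im_ofReal_mul, h3.2, mul_zero]⟩

end PositiveDefiniteness

/-! ### Autocorrelation of the cut-and-project comb. -/

section CutAndProjectCombs

variable {d m : ℕ} {Λ : Submodule ℤ (EuclideanSpace ℝ (Fin d) × EuclideanSpace ℝ (Fin m))}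
  {n : ℕ} {K : NNReal} {ρ c : ℝ} {f : EuclideanSpace ℝ (Fin m) → ℂ}

local notation "𝔼" => EuclideanSpace ℝ (Fin d)
local notation "𝔽" => EuclideanSpace ℝ (Fin m)

theorem IsDenseCutAndProject.injective_fst (hΛ : IsDenseCutAndProject Λ) :
    Function.Injective fun l : Λ => (l : 𝔼 × 𝔽).1 :=
  fun a b h => Subtype.ext (hΛ.injOn_fst a.2 b.2 h)

theorem IsDenseCutAndProject.starMap_fst (hΛ : IsDenseCutAndProject Λ) (l : Λ) :
    starMap Λ (l : 𝔼 × 𝔽).1 = (l : 𝔼 × 𝔽).2 := by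
  have h : ∃ a ∈ (Λ : Set (𝔼 × 𝔽)), Prod.fst a = (l : 𝔼 × 𝔽).1 := ⟨l, l.2, rfl⟩
  have h1 := Function.invFunOn_mem h
  have h2 := Function.invFunOn_eq h
  rw [starMap, hΛ.injOn_fst h1 l.2 h2]

theorem fst_mem_directModule (l : Λ) : (l : 𝔼 × 𝔽).1 ∈ directModule Λ := ⟨l, l.2, rfl⟩

theorem mem_range_fst_of_mem_directModule {x : 𝔼} (hx : x ∈ directModule Λ) :
    x ∈ range fun l : Λ => (l : 𝔼 × 𝔽).1 := by
  obtain ⟨l, hl, rfl⟩ := hx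
  exact ⟨⟨l, hl⟩, rfl⟩

theorem directModule_inter_indicator (A : Set 𝔼) (e : 𝔼 → ℂ) (l : Λ) :
    (directModule Λ ∩ A).indicator e (l : 𝔼 × 𝔽).1 = A.indicator e (l : 𝔼 × 𝔽).1 := by
  have := fst_mem_directModule l
  by_cases h : (l : 𝔼 × 𝔽).1 ∈ A <;> simp [indicator, h, this]

theorem CountingBound.locallySummable (hK : CountingBound Λ n K ρ) (hΛ : IsDenseCutAndProject Λ)
    {e : 𝔼 → ℂ} (he : ∀ l : Λ, ‖e (l : 𝔼 × 𝔽).1‖ ≤ c * decayWeight n (l : 𝔼 × 𝔽).2) :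
    LocallySummable (directModule Λ) e := by
  intro B hB
  rw [← hΛ.injective_fst.summable_iff]
  · refine Summable.of_norm_bounded ((hK.hasSum hB 0).summable.mul_left c) fun l => ?_
    rw [Function.comp_apply, directModule_inter_indicator]
    by_cases h : (l : 𝔼 × 𝔽).1 ∈ B <;> simp [h, he]
  · intro x hx
    exact indicator_of_notMem (fun h => hx (mem_range_fst_of_mem_directModule h.1)) _

theorem isAtomic_restrict_directModule (hΛ : IsDenseCutAndProject Λ) {e : 𝔼 → ℂ}
    (he : LocallySummable (directModule Λ) e) {B : Set 𝔼} (hB : MeasurableSet B)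
    (hB' : IsBounded B) :
    IsAtomic ((diracComb (directModule Λ) e).restrict B) (fun l : Λ => (l : 𝔼 × 𝔽).1)
      (fun l => B.indicator e (l : 𝔼 × 𝔽).1) := by
  have h := (isAtomic_restrict_diracComb he hB hB').comp_injective hΛ.injective_fst
    fun x hx => mem_range_fst_of_mem_directModule (by
      by_contra h
      exact hx (indicator_of_notMem (fun h' => h h'.1) _))
  refine ⟨?_, fun A hA => ?_⟩
  · exact h.summable.congr fun l => directModule_inter_indicator B e l
  · convert! h.hasSum A hA using 2
    funext l
    exact (directModule_inter_indicator B e l).symm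

theorem hasSum_integral_directModule (hΛ : IsDenseCutAndProject Λ) {e : 𝔼 → ℂ}
    (he : LocallySummable (directModule Λ) e) {g : 𝔼 → ℂ} (hg : Continuous g)
    (hg' : HasCompactSupport g) :
    HasSum (fun l : Λ => g (l : 𝔼 × 𝔽).1 * e (l : 𝔼 × 𝔽).1)
      ((diracComb (directModule Λ) e).integral g) := by
  obtain ⟨C, hC⟩ := hg.bounded_above_of_compact_support hg'
  have h := (isAtomic_restrict_directModule hΛ he (isClosed_tsupport g).measurableSet
    hg'.isBounded).hasSum_integral hg.stronglyMeasurable hC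
  convert! h using 2 with l
  by_cases hl : (l : 𝔼 × 𝔽).1 ∈ tsupport g
  · rw [indicator_of_mem hl]
  · rw [image_eq_zero_of_notMem_tsupport hl, zero_mul, zero_mul]

theorem isAtomic_finiteAutocorrelation (hΛ : IsDenseCutAndProject Λ)
    (hf : LocallySummable (directModule Λ) fun x => f (starMap Λ x)) (r : ℝ) :
    IsAtomic (finiteAutocorrelation (denseComb Λ f) r)
      (fun p : Λ × Λ => (p.1 : 𝔼 × 𝔽).1 - (p.2 : 𝔼 × 𝔽).1)
      (fun p => (((volume.real (Metric.closedBall (0 : 𝔼) r))⁻¹ : ℝ) : ℂ) *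
        ((Metric.closedBall 0 r).indicator (fun x => f (starMap Λ x)) (p.1 : 𝔼 × 𝔽).1 *
        starRingEnd ℂ ((Metric.closedBall 0 r).indicator (fun x => f (starMap Λ x))
          (p.2 : 𝔼 × 𝔽).1))) := by
  have h := isAtomic_restrict_directModule hΛ hf
    (Metric.isClosed_closedBall (x := (0 : 𝔼)) (ε := r)).measurableSet Metric.isBounded_closedBall
  have h1 := ((h.prod ((h.map measurable_neg).mapRange_conj)).map
    (measurable_fst.add measurable_snd)).smul
      (((volume.real (Metric.closedBall (0 : 𝔼) r))⁻¹ : ℝ) : ℂ)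
  have h2 : (fun p : Λ × Λ => (p.1 : 𝔼 × 𝔽).1 - (p.2 : 𝔼 × 𝔽).1)
      = (fun p : 𝔼 × 𝔼 => p.1 + p.2) ∘ fun p : Λ × Λ =>
        ((p.1 : 𝔼 × 𝔽).1, ((fun x : 𝔼 => -x) ∘ fun l : Λ => (l : 𝔼 × 𝔽).1) p.2) := by
    funext p
    simp [sub_eq_add_neg]
  rw [h2]
  exact h1

/-- The coefficient of the finite autocorrelation at the projection of a lattice point. -/
def finiteCoeff (Λ : Submodule ℤ (𝔼 × 𝔽)) (f : 𝔽 → ℂ) (r : ℝ) (z : 𝔼 × 𝔽) : ℂ :=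
  ((volume.real (Metric.closedBall (0 : 𝔼) r) : ℂ))⁻¹ *
    latSum Λ (Metric.closedBall 0 r ∩ (fun x => x + -z.1) ⁻¹' Metric.closedBall 0 r)
      (corrFun f z.2)

/-- The bijection `(z, l) ↦ (l, l - z)`. -/
def diffEquiv (Λ : Submodule ℤ (𝔼 × 𝔽)) : Λ × Λ ≃ Λ × Λ where
  toFun p := (p.2, p.2 - p.1)
  invFun p := (p.1 - p.2, p.1)
  left_inv p := by simp
  right_inv p := by simp

/-- Pairs of lattice points are regrouped by their difference `z`. For fixed `z`, the two ball
conditions say that `l` lies above `B_r ∩ (B_r + z)`. -/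
theorem CountingBound.integral_finiteAutocorrelation (hK : CountingBound Λ n K ρ)
    (hΛ : IsDenseCutAndProject Λ)
    (hf : LocallySummable (directModule Λ) fun x => f (starMap Λ x)) (hc : 0 ≤ c)
    (hfc : ∀ u, ‖f u‖ ≤ c * decayWeight n u) {g : 𝔼 → ℂ} (hg : Continuous g)
    (hg' : HasCompactSupport g) (r : ℝ) :
    ∫ᵛ x, g x ∂[ContinuousLinearMap.mul ℝ ℂ; finiteAutocorrelation (denseComb Λ f) r]
      = ∑' z : Λ, g (z : 𝔼 × 𝔽).1 * finiteCoeff Λ f r z := by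
  obtain ⟨C, hC⟩ := hg.bounded_above_of_compact_support hg'
  have h := (isAtomic_finiteAutocorrelation hΛ hf r).hasSum_integral hg.stronglyMeasurable hC
  rw [← (diffEquiv Λ).hasSum_iff] at h
  refine (HasSum.tsum_eq (h.prod_fiberwise fun z => ?_)).symm
  have hb : IsBounded (Metric.closedBall (0 : 𝔼) r ∩
      (fun x => x + -(z : 𝔼 × 𝔽).1) ⁻¹' Metric.closedBall 0 r) :=
    Metric.isBounded_closedBall.subset inter_subset_left
  have h1 := (((hK.summable (v := 0) hb (G := corrFun f (z : 𝔼 × 𝔽).2)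
    (fun u => by simpa using norm_corrFun_le hc hfc _ u)).hasSum.mul_left
    ((volume.real (Metric.closedBall (0 : 𝔼) r) : ℂ))⁻¹)).mul_left (g (z : 𝔼 × 𝔽).1)
  convert! h1 using 2 with l
  have hz : (l : 𝔼 × 𝔽).1 - ((l - z : Λ) : 𝔼 × 𝔽).1 = (z : 𝔼 × 𝔽).1 := by simp
  have hl : ((l - z : Λ) : 𝔼 × 𝔽).1 = (l : 𝔼 × 𝔽).1 + -(z : 𝔼 × 𝔽).1 := by
    simp [sub_eq_add_neg]
  simp only [diffEquiv, Function.comp_apply, Equiv.coe_fn_mk, hz, Complex.ofReal_inv]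
  congr 2
  by_cases h2 : (l : 𝔼 × 𝔽).1 ∈ Metric.closedBall (0 : 𝔼) r
  · by_cases h3 : ((l - z : Λ) : 𝔼 × 𝔽).1 ∈ Metric.closedBall (0 : 𝔼) r
    · rw [indicator_of_mem h2, indicator_of_mem h3, hΛ.starMap_fst, hΛ.starMap_fst,
        indicator_of_mem (mem_inter h2 (by rw [mem_preimage, ← hl]; exact h3))]
      rfl
    · rw [indicator_of_notMem h3, map_zero, mul_zero, indicator_of_notMem]
      exact fun h4 => h3 (by rw [hl]; exact h4.2)
  · rw [indicator_of_notMem h2, zero_mul, indicator_of_notMem]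
    exact fun h4 => h2 h4.1

/-- The factor `4` comes from the two weights in `norm_corrFun_le_mul_add` and the volume ratio `2`.
The bound is free of `r`, so it dominates the coefficients. -/
theorem CountingBound.norm_finiteCoeff_le (hK : CountingBound Λ n K ρ) (hc : 0 ≤ c)
    (hfc : ∀ u, ‖f u‖ ≤ c * decayWeight n u) {r : ℝ} (hr0 : 0 < r)
    (hr : volume.real (Metric.closedBall (0 : 𝔼) (r + ρ))
      ≤ 2 * volume.real (Metric.closedBall (0 : 𝔼) r)) (z : 𝔼 × 𝔽) :
    ‖finiteCoeff Λ f r z‖ ≤ 4 * (c * c * 2 ^ n) * K * decayWeight n z.2 := by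
  have hV := volume_real_closedBall_pos (E := 𝔼) hr0
  rw [finiteCoeff, norm_mul, norm_inv, Complex.norm_of_nonneg measureReal_nonneg,
    inv_mul_le_iff₀ hV]
  set A := Metric.closedBall (0 : 𝔼) r ∩ (fun x => x + -z.1) ⁻¹' Metric.closedBall 0 r with hA
  have hb : IsBounded A := Metric.isBounded_closedBall.subset inter_subset_left
  have hvol : volume.real (Metric.thickening ρ A)
      ≤ 2 * volume.real (Metric.closedBall (0 : 𝔼) r) :=
    (measureReal_mono (thickening_subset_closedBall inter_subset_left)
      measure_closedBall_lt_top.ne).trans hr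
  set C := c * c * 2 ^ n * decayWeight n z.2 with hCdef
  have hC : 0 ≤ C := by have := decayWeight_pos n z.2; positivity
  have h1 := ((hK.hasSum hb 0).add (hK.hasSum hb (-z.2))).mul_left C
  have h2 : ‖latSum Λ A (corrFun f z.2)‖ ≤ _ := tsum_of_norm_bounded h1 fun l => by
    by_cases h : (l : 𝔼 × 𝔽).1 ∈ A
    · simp only [indicator_of_mem h, add_zero, ← sub_eq_add_neg]
      exact norm_corrFun_le_mul_add hc hfc _ _
    · simp [indicator_of_notMem h]
  refine h2.trans ?_
  have h3 := hK.toReal_tsum_le hb 0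
  have h4 := hK.toReal_tsum_le hb (-z.2)
  calc _ ≤ C * (K * (2 * volume.real (Metric.closedBall (0 : 𝔼) r))
        + K * (2 * volume.real (Metric.closedBall (0 : 𝔼) r))) := by
        refine mul_le_mul_of_nonneg_left (add_le_add (h3.trans ?_) (h4.trans ?_)) hC <;> gcongr
    _ = _ := by rw [hCdef]; ring

theorem autocorrCoeff_eq (hΛ : IsDenseCutAndProject Λ) (z : Λ) :
    autocorrCoeff Λ f (z : 𝔼 × 𝔽).1
      = ((ZLattice.covolume Λ volume : ℝ) : ℂ)⁻¹ * ∫ u, corrFun f (z : 𝔼 × 𝔽).2 u := by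
  rw [autocorrCoeff, hΛ.starMap_fst]
  rfl

theorem exists_norm_autocorrCoeff_le (hΛ : IsDenseCutAndProject Λ) (hn : m < n) (hc : 0 ≤ c)
    (hfc : ∀ u, ‖f u‖ ≤ c * decayWeight n u) :
    ∃ C : ℝ, ∀ z : Λ, ‖autocorrCoeff Λ f (z : 𝔼 × 𝔽).1‖
      ≤ C * decayWeight n (z : 𝔼 × 𝔽).2 := by
  have hW : Integrable (decayWeight n : 𝔽 → ℝ) := integrable_decayWeight volume (by simpa using hn)
  refine ⟨‖((ZLattice.covolume Λ volume : ℝ) : ℂ)⁻¹‖ *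
    (c * c * 2 ^ n * (2 * ∫ u : 𝔽, decayWeight n u)), fun z => ?_⟩
  rw [autocorrCoeff_eq hΛ, norm_mul, mul_assoc]
  refine mul_le_mul_of_nonneg_left ?_ (norm_nonneg _)
  set v := (z : 𝔼 × 𝔽).2
  have hW' : Integrable (fun u : 𝔽 => decayWeight n (u - v)) := hW.comp_sub_right v
  calc ‖∫ u, corrFun f v u‖
      ≤ ∫ u, c * c * 2 ^ n * decayWeight n v * (decayWeight n u + decayWeight n (u - v)) :=
        norm_integral_le_of_norm_le ((hW.add hW').const_mul _)
          (Eventually.of_forall (norm_corrFun_le_mul_add hc hfc v))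
    _ = _ := by
      rw [integral_const_mul, integral_add hW hW',
        integral_sub_right_eq_self (fun u : 𝔽 => decayWeight n u) v]
      ring

theorem CountingBound.tendsto_finiteCoeff [DiscreteTopology Λ] [IsZLattice ℝ Λ]
    (hK : CountingBound Λ n K ρ) (hρ : 0 < ρ) (hΛ : IsDenseCutAndProject Λ) (hn : m < n)
    (hf : Continuous f) (hc : 0 ≤ c) (hfc : ∀ u, ‖f u‖ ≤ c * decayWeight n u)
    (hlim : Tendsto (fun u => ‖f u‖ / decayWeight n u) (cocompact 𝔽) (𝓝 0)) (z : Λ) :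
    Tendsto (fun r => finiteCoeff Λ f r z) atTop (𝓝 (autocorrCoeff Λ f (z : 𝔼 × 𝔽).1)) := by
  set v := (z : 𝔼 × 𝔽).2 with hv
  have hG := norm_corrFun_le hc hfc v
  have hG0 : ∀ u, ‖corrFun f v u‖ ≤ c * c * decayWeight n (u + 0) := by simpa using hG
  have h1 := hK.tendsto_latSum hρ (by simpa using hn) hΛ.dense_snd (continuous_corrFun hf v)
    (mul_nonneg hc hc) hG (tendsto_corrFun_div_decayWeight hc hfc hlim v)
  -- Intersecting `B_r` with its translate alters it only within an annulus of fixed width.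
  have h2 := hK.tendsto_latSum_sub hρ (norm_nonneg (-(z : 𝔼 × 𝔽).1))
    (A := fun r => Metric.closedBall 0 r ∩
      (fun x => x + -(z : 𝔼 × 𝔽).1) ⁻¹' Metric.closedBall 0 r)
    (fun r => Subset.trans (fun x hx => by
      simp only [mem_symmDiff, mem_inter_iff] at hx ⊢
      tauto) (symmDiff_preimage_add_subset_annulus (-(z : 𝔼 × 𝔽).1) r))
    (mul_nonneg hc hc) hG0
  have h3 := h2.add h1
  rw [zero_add, ← autocorrCoeff_eq hΛ] at h3
  refine h3.congr fun r => ?_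
  rw [finiteCoeff]
  ring

theorem CountingBound.isAutocorrelation [DiscreteTopology Λ] [IsZLattice ℝ Λ]
    (hK : CountingBound Λ n K ρ) (hρ : 0 < ρ) (hΛ : IsDenseCutAndProject Λ) (hn : m < n)
    (hf : Continuous f) (hc : 0 ≤ c) (hfc : ∀ u, ‖f u‖ ≤ c * decayWeight n u)
    (hlim : Tendsto (fun u => ‖f u‖ / decayWeight n u) (cocompact 𝔽) (𝓝 0))
    (hfs : LocallySummable (directModule Λ) fun x => f (starMap Λ x))
    (hηs : LocallySummable (directModule Λ) (autocorrCoeff Λ f)) :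
    IsAutocorrelation (denseComb Λ f) (diracComb (directModule Λ) (autocorrCoeff Λ f)) := by
  intro g hg hg'
  rw [← (hasSum_integral_directModule hΛ hηs hg hg').tsum_eq]
  simp_rw [hK.integral_finiteAutocorrelation hΛ hfs hc hfc hg hg']
  obtain ⟨M, hM⟩ := hg.bounded_above_of_compact_support hg'
  have hM0 : 0 ≤ M := (norm_nonneg _).trans (hM 0)
  set C := 4 * (c * c * 2 ^ n) * (K : ℝ) with hC
  have hC0 : 0 ≤ C := by positivity
  -- Only `z` above the support of `g` contribute, and the weights of those are summable.
  refine tendsto_tsum_of_dominated_convergence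
    (bound := fun z : Λ => M * C * (tsupport g).indicator
      (fun _ => decayWeight n ((z : 𝔼 × 𝔽).2 + 0)) (z : 𝔼 × 𝔽).1)
    ((hK.hasSum hg'.isBounded 0).summable.mul_left _)
    (fun z => (hK.tendsto_finiteCoeff hρ hΛ hn hf hc hfc hlim z).const_mul _) ?_
  filter_upwards [eventually_gt_atTop 0, eventually_volume_closedBall_add_le (E := 𝔼) ρ]
    with r hr0 hr z
  by_cases hz : (z : 𝔼 × 𝔽).1 ∈ tsupport g
  · rw [indicator_of_mem hz, norm_mul, add_zero, mul_assoc]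
    exact mul_le_mul (hM _) (hK.norm_finiteCoeff_le hc hfc hr0 hr z) (norm_nonneg _) hM0
  · rw [image_eq_zero_of_notMem_tsupport hz, indicator_of_notMem hz]
    simp

theorem positiveDefinite_of_isAutocorrelation (hΛ : IsDenseCutAndProject Λ)
    (hfs : LocallySummable (directModule Λ) fun x => f (starMap Λ x))
    {γ : LocalComplexMeasure 𝔼} (hγ : IsAutocorrelation (denseComb Λ f) γ) :
    γ.PositiveDefinite := by
  intro g hg hg'
  have hkc : Continuous (convolution g (tildeFun g) (ContinuousLinearMap.mul ℝ ℂ) volume) :=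
    (hasCompactSupport_tildeFun hg').continuous_convolution_right _
      hg.locallyIntegrable (continuous_tildeFun hg)
  have hks : HasCompactSupport
      (convolution g (tildeFun g) (ContinuousLinearMap.mul ℝ ℂ) volume) :=
    hg'.convolution _ (hasCompactSupport_tildeFun hg')
  exact isClosed_nonnegReals.mem_of_tendsto (hγ _ hkc hks) (Eventually.of_forall fun r =>
    (isAtomic_finiteAutocorrelation hΛ hfs r).integral_convolution_tildeFun_mem
      (x := fun l : Λ => (l : 𝔼 × 𝔽).1)
      (w := fun l : Λ => (Metric.closedBall 0 r).indicator (fun x => f (starMap Λ x))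
        (l : 𝔼 × 𝔽).1) (inv_nonneg.2 measureReal_nonneg) hg hg')

/-- The counting bound involves only the volume of a neighbourhood of `y + S`, which lies in a ball
centred at `y` of radius independent of `y`. -/
theorem CountingBound.translationBounded (hK : CountingBound Λ n K ρ)
    (hΛ : IsDenseCutAndProject Λ) {e : 𝔼 → ℂ} (he' : LocallySummable (directModule Λ) e)
    (he : ∀ l : Λ, ‖e (l : 𝔼 × 𝔽).1‖ ≤ c * decayWeight n (l : 𝔼 × 𝔽).2) :
    (diracComb (directModule Λ) e).TranslationBounded := by
  intro S hS
  obtain ⟨R, hR⟩ := hS.isBounded.subset_closedBall 0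
  have hfin : ENNReal.ofReal c * (K * volume (Metric.closedBall (0 : 𝔼) (R + ρ))) ≠ ⊤ :=
    ENNReal.mul_ne_top ENNReal.ofReal_ne_top
      (ENNReal.mul_ne_top ENNReal.coe_ne_top measure_closedBall_lt_top.ne)
  refine ⟨_, fun y => le_of_le_of_eq ?_ (ENNReal.coe_toNNReal hfin).symm⟩
  set A := (fun x => y + x) '' S with hA
  have hAc : IsCompact A := hS.image (continuous_const_add y)
  have hthick : Metric.thickening ρ A ⊆ Metric.closedBall y (R + ρ) := by
    intro x hx
    obtain ⟨_, ⟨s, hs, rfl⟩, hxs⟩ := Metric.mem_thickening_iff.1 hx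
    have h1 := mem_closedBall_zero_iff.1 (hR hs)
    rw [Metric.mem_closedBall]
    have h2 := dist_triangle x (y + s) y
    have h3 : dist (y + s) y = ‖s‖ := by rw [dist_eq_norm, add_sub_cancel_left]
    linarith
  rw [LocalComplexMeasure.variation]
  refine ((isAtomic_restrict_directModule hΛ he' hAc.measurableSet
    hAc.isBounded).variation_apply_le hAc.measurableSet).trans ?_
  calc _ ≤ ∑' l : Λ, ENNReal.ofReal c * A.indicator
        (fun _ => ENNReal.ofReal (decayWeight n ((l : 𝔼 × 𝔽).2 + 0))) (l : 𝔼 × 𝔽).1 := by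
        refine ENNReal.tsum_le_tsum fun l => ?_
        by_cases h : (l : 𝔼 × 𝔽).1 ∈ A
        · rw [indicator_of_mem (show l ∈ (fun l : Λ => (l : 𝔼 × 𝔽).1) ⁻¹' A from h), indicator_of_mem h, indicator_of_mem h,
            ← ENNReal.ofReal_mul' (decayWeight_pos n _).le, add_zero, ← ofReal_norm]
          exact ENNReal.ofReal_le_ofReal (he l)
        · rw [indicator_of_notMem (show l ∉ (fun l : Λ => (l : 𝔼 × 𝔽).1) ⁻¹' A from h)]
          exact zero_le
    _ = ENNReal.ofReal c * ∑' l : Λ, A.indicator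
        (fun _ => ENNReal.ofReal (decayWeight n ((l : 𝔼 × 𝔽).2 + 0))) (l : 𝔼 × 𝔽).1 :=
      ENNReal.tsum_mul_left
    _ ≤ ENNReal.ofReal c * (K * volume (Metric.thickening ρ A)) := by
      gcongr
      exact hK A 0
    _ ≤ _ := by
      rw [← Measure.addHaar_closedBall_center volume y (R + ρ)]
      gcongr

end CutAndProjectCombs

end DenseComb

end

/-! ### The theorem. -/

theorem theorem3p4 {d m : ℕ}
    (Λ : Submodule ℤ (EuclideanSpace ℝ (Fin d) × EuclideanSpace ℝ (Fin m)))
    [DiscreteTopology Λ] [IsZLattice ℝ Λ] (hΛ : DenseComb.IsDenseCutAndProject Λ)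
    (f : EuclideanSpace ℝ (Fin m) → ℂ) (hf : Continuous f)
    (C α : ℝ) (hC : 0 < C) (hα : 0 < α)
    (hdecay : ∀ x, ‖x‖ ^ ((m : ℝ) + 1 + α) * ‖f x‖ ≤ C) :
    -- the comb `ω` and the measure `∑ η(z) δ_z` are well defined
    DenseComb.LocallySummable (DenseComb.directModule Λ) (fun x => f (DenseComb.starMap Λ x)) ∧
    (∀ z ∈ DenseComb.directModule Λ,
      Integrable fun u => f u * starRingEnd ℂ (f (u - DenseComb.starMap Λ z))) ∧
    DenseComb.LocallySummable (DenseComb.directModule Λ) (DenseComb.autocorrCoeff Λ f) ∧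
    ∃ γ : DenseComb.LocalComplexMeasure (EuclideanSpace ℝ (Fin d)),
      γ = DenseComb.diracComb (DenseComb.directModule Λ) (DenseComb.autocorrCoeff Λ f) ∧
      DenseComb.IsAutocorrelation (DenseComb.denseComb Λ f) γ ∧
      (∀ γ' : DenseComb.LocalComplexMeasure (EuclideanSpace ℝ (Fin d)),
        DenseComb.IsAutocorrelation (DenseComb.denseComb Λ f) γ' → γ' = γ) ∧
      γ.TranslationBounded ∧ γ.PositiveDefinite ∧ γ.PurePoint := by
  -- The exponent `m + 1` is the least integer making the weight integrable on `ℝ^m`, and leaves `α`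
  -- to spare.
  have hdecay' : ∀ x, ‖x‖ ^ (((m + 1 : ℕ) : ℝ) + α) * ‖f x‖ ≤ C := by
    simpa only [Nat.cast_add, Nat.cast_one] using hdecay
  obtain ⟨c, hc, hfc⟩ := DenseComb.exists_norm_le_mul_decayWeight hα hf hdecay'
  have hlim := DenseComb.tendsto_norm_div_decayWeight hα hdecay'
  have hn : m < m + 1 := Nat.lt_succ_self m
  have hn' : Module.finrank ℝ (EuclideanSpace ℝ (Fin m)) < m + 1 := by simp
  obtain ⟨K, ρ, hρ, hK⟩ := DenseComb.exists_tsum_decayWeight_le Λ hn'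
  obtain ⟨Cη, hη⟩ := DenseComb.exists_norm_autocorrCoeff_le hΛ hn hc hfc
  have hfs : DenseComb.LocallySummable (DenseComb.directModule Λ)
      (fun x => f (DenseComb.starMap Λ x)) :=
    hK.locallySummable hΛ fun l => by rw [hΛ.starMap_fst]; exact hfc _
  have hηs := hK.locallySummable hΛ hη
  have hauto := hK.isAutocorrelation hρ hΛ hn hf hc hfc hlim hfs hηs
  refine ⟨hfs, fun z _ => DenseComb.integrable_of_le_decayWeight hn'
    (DenseComb.continuous_corrFun hf _) (DenseComb.norm_corrFun_le hc hfc _), hηs,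
    _, rfl, hauto, fun γ' hγ' => ?_, hK.translationBounded hΛ hηs hη,
    DenseComb.positiveDefinite_of_isAutocorrelation hΛ hfs hauto,
    DenseComb.purePoint_diracComb hηs⟩
  exact DenseComb.LocalComplexMeasure.ext_of_integral fun g hg hg' =>
    tendsto_nhds_unique (hγ' g hg hg') (hauto g hg hg')
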